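/- **Proposition 3.5.** Let $E/\mathbb{Q}$ be an elliptic curve with full rational $2$-torsion, i.e. $E[2](\overline{\mathbb{Q}}) \subseteq E(\mathbb{Q})$. Let $p \equiv 1 \pmod 3$ be a prime of good reduction for $E$, and let $a_p(E) = p + 1 - \#\widetilde{E}(\mathbb{F}_p)$, where $\widetilde{E}/\mathbb{F}_p$ is the reduction of (a minimal model of) $E$ at $p$. Let $\rho_3^E$ be the representation of $G_{\mathbb{Q}} = \mathrm{Gal}(\overline{\mathbb{Q}}/\mathbb{Q})$ on the $\mathbb{F}_3$-vector space $E[3](\overline{\mathbb{Q}})$ given by the natural Galois action. If $3 \mid a_p(E)$, then $\rho_3^E$ is strongly irreducible, i.e. the restriction of $\rho_3^E$ to the subgroup $\mathrm{Gal}(\overline{\mathbb{Q}}/\mathbb{Q}(\sqrt{-3}))$ is absolutely irreducible. -/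

import Mathlib

noncomputable section

namespace ModThree

open scoped TensorProduct

/-- A fixed algebraic closure `ℚ̄` of `ℚ`. -/
abbrev QBar : Type := AlgebraicClosure ℚ

instance : DecidableEq QBar := Classical.decEq _

/-- The absolute Galois group `G_ℚ = Gal(ℚ̄/ℚ)`. -/
abbrev GQ : Type := QBar ≃ₐ[ℚ] QBar

/-! ### Irreducibility notions for representations -/

section Representation

variable {k G V : Type*} [Field k] [Group G] [AddCommGroup V] [Module k V]

/-- The extension of scalars `k' ⊗ ρ` of a representation `ρ` over `k` to a field `k' / k`. -/
def extendScalars (k' : Type*) [Field k'] [Algebra k k'] (ρ : Representation k G V) :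
    Representation k' G (k' ⊗[k] V) where
  toFun g := (ρ g).baseChange k'
  map_one' := by rw [map_one]; exact LinearMap.baseChange_one k V
  map_mul' g h := by rw [map_mul]; exact LinearMap.baseChange_mul (ρ g) (ρ h)

/-- A representation over `k` is absolutely irreducible if it is irreducible after extension of
scalars to an algebraic closure of `k`. -/
def IsAbsolutelyIrreducible (ρ : Representation k G V) : Prop :=
  (extendScalars (AlgebraicClosure k) ρ).IsIrreducible

end Representation

/-- The integer `l* = (-1)^((l-1)/2) l` attached to an odd prime `l`. -/
def lStar (l : ℕ) : ℤ := (-1) ^ ((l - 1) / 2) * (l : ℤ)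

/-- The quadratic field `ℚ(√l*)`, as a subfield of `ℚ̄`. -/
def quadraticField (l : ℕ) : IntermediateField ℚ QBar :=
  IntermediateField.adjoin ℚ {x : QBar | x ^ 2 = (lStar l : QBar)}

/-- A mod `l` representation `ρ` of `G_ℚ` (with `l` an odd prime) is strongly irreducible if its
restriction to the subgroup `G_{ℚ(√l*)}` of `G_ℚ` is absolutely irreducible. -/
def IsStronglyIrreducible (l : ℕ) [Fact l.Prime] {V : Type*} [AddCommGroup V]
    [Module (ZMod l) V] (ρ : Representation (ZMod l) GQ V) : Prop :=
  IsAbsolutelyIrreducible (ρ.comp (quadraticField l).fixingSubgroup.subtype)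

/-! ### The mod `n` representation of an elliptic curve over `ℚ` -/

/-- The `n`-torsion group `E[n] = E[n](ℚ̄)`. -/
abbrev Torsion (E : WeierstrassCurve ℚ) (n : ℕ) : Type :=
  AddSubgroup.torsionBy (E.baseChange QBar).toAffine.Point (n : ℤ)

/-- `E[n]` is a module over `ℤ/nℤ`. -/
instance torsionModule (E : WeierstrassCurve ℚ) (n : ℕ) : Module (ZMod n) (Torsion E n) :=
  AddSubgroup.torsionBy.zmodModule

/-- The action of `σ ∈ G_ℚ` on `E(ℚ̄)`, by `(x, y) ↦ (σ x, σ y)`. -/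
def galPoint (E : WeierstrassCurve ℚ) (σ : GQ) :
    (E.baseChange QBar).toAffine.Point →+ (E.baseChange QBar).toAffine.Point :=
  WeierstrassCurve.Affine.Point.map (W' := E) (σ : QBar →ₐ[ℚ] QBar)

/-- The action of `σ ∈ G_ℚ` on `E[n]`. -/
def galTorsion (E : WeierstrassCurve ℚ) (n : ℕ) (σ : GQ) : Torsion E n →+ Torsion E n :=
  ((galPoint E σ).comp (AddSubgroup.subtype _)).codRestrict _ fun P => by
    rw [AddSubgroup.torsionBy.nsmul_iff, AddMonoidHom.comp_apply, ← map_nsmul]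
    exact (congrArg _ (AddSubgroup.torsionBy.nsmul_iff.mp P.2)).trans (map_zero _)

/-- The mod `n` Galois representation `ρ_n^E` of `G_ℚ` on `E[n]`. -/
def torsionRep (E : WeierstrassCurve ℚ) (n : ℕ) : Representation (ZMod n) GQ (Torsion E n) where
  toFun σ := (galTorsion E n σ).toZModLinearMap n
  map_one' := by
    ext P
    exact WeierstrassCurve.Affine.Point.map_id P.1
  map_mul' σ τ := by
    ext P
    exact (WeierstrassCurve.Affine.Point.map_map (τ : QBar →ₐ[ℚ] QBar)
      (σ : QBar →ₐ[ℚ] QBar) P.1).symm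

/-- `E/ℚ` has full rational `2`-torsion: every point of `E[2](ℚ̄)` lies in `E(ℚ)`. -/
def HasFullRationalTwoTorsion (E : WeierstrassCurve ℚ) : Prop :=
  ∀ P : (E.baseChange QBar).toAffine.Point, 2 • P = 0 →
    P ∈ Set.range (WeierstrassCurve.Affine.Point.baseChange (W' := E) ℚ QBar)

/-! ### Reduction at a prime -/

section Reduction

variable (E : WeierstrassCurve ℚ) (p : ℕ) [Fact p.Prime]

/-- A minimal Weierstrass model of `E` at `p`, that is, over `ℤ_p`. -/
def localMinimalModel : WeierstrassCurve ℚ_[p] :=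
  (E.baseChange ℚ_[p]).minimal ℤ_[p]

instance : (localMinimalModel E p).IsMinimal ℤ_[p] :=
  inferInstanceAs (((E.baseChange ℚ_[p]).minimal ℤ_[p]).IsMinimal ℤ_[p])

/-- `E` has good reduction at `p`. -/
def HasGoodReductionAt : Prop :=
  (localMinimalModel E p).HasGoodReduction ℤ_[p]

/-- The trace of Frobenius `a_p(E) = p + 1 - #Ẽ(𝔽_p)` at a prime `p` of good reduction, where `Ẽ`
is the reduction of a minimal model of `E` at `p`, a curve over the residue field `𝔽_p` of `ℤ_p`. -/
def traceOfFrobenius : ℤ :=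
  (p : ℤ) + 1 - (Nat.card ((localMinimalModel E p).reduction ℤ_[p]).toAffine.Point : ℤ)

end Reduction

end ModThree

end

/-! Let `K = ℚ(√-3)` and suppose that `E[3]` is not absolutely irreducible over `G_K`. Then either
`G_K` stabilises a line, or it acts through `𝔽₉ˣ` (`of_not_isAbsolutelyIrreducible`).

A stable line puts a root of the 3-division polynomial `Ψ₃` in `K`. Since `p ≡ 1 mod 3`, `K` embeds
in `ℚ_p` and the root reduces to `𝔽_p`, so the reduced curve or its quadratic twist has a rational
point of order 3. But these have `p + 1 ∓ a_p ≡ 2 mod 3` points (`eval_Ψ₃_ne_zero_of_three_dvd`).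

In the other case `𝔽₉ˣ/±1`, cyclic of order 4, permutes the four roots of `Ψ₃`. The discriminant
`-27Δ²` is a square in `K`, which excludes 4-cycles. As no root lies in `K`, the image of `G_K` on
the roots is generated by a double transposition `τ`. Since `G_K` is normal, `G_ℚ` commutes with `τ`
on the roots, so it preserves or exchanges the two pairs. If some element exchanges them, `Ψ₃` is 3
times the norm of a quadratic over `K`, hence nonnegative at rational numbers; but it is negative at
the abscissa of a 2-torsion point (`not_conjugate_factors`). If none does, `Ψ₃` is 3 times a product
of two rational quadratics. Its resolvent cubic is pure (`resolvent_Ψ₃`), so `Δ` is a rational cube.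
With `A`, `B` the successive differences of the 2-torsion abscissae, `Δ = 16(AB(A+B))²`, so
`4AB(A+B)` is a cube, and Euler's theorem on `x³ + y³ = 2z³` puts the abscissae in arithmetic
progression. Then `Ψ₃` is a translate of `3X⁴ - 6D²X² - D⁴`, which has no such factorization
(`not_product_of_quadratics`). -/

/-! ### Euler's descent for `x³ + y³ = 2z³` -/

section EulerCubes

open NumberField in
/-- The ring of Eisenstein integers, described by the properties used below. -/
theorem exists_eisenstein_ring :
    ∃ (R : Type) (_ : CommRing R) (_ : IsDomain R) (_ : IsPrincipalIdealRing R) (_ : CharZero R)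
      (ω : R), ω ^ 2 + ω + 1 = 0 ∧ (∀ x : R, ∃ c d : ℤ, x = c + d * ω) ∧
      ∀ u : Rˣ, ∃ k : Fin 3, (u : R) = ω ^ (k : ℕ) ∨ (u : R) = -ω ^ (k : ℕ) := by
  have : NeZero ((3 : ℕ) : ℚ) := ⟨by norm_num⟩
  have : IsCyclotomicExtension {3} ℚ (CyclotomicField 3 ℚ) :=
    CyclotomicField.isCyclotomicExtension 3 ℚ
  have : NumberField (CyclotomicField 3 ℚ) := IsCyclotomicExtension.numberField {3} ℚ _
  have hζ : IsPrimitiveRoot (IsCyclotomicExtension.zeta 3 ℚ (CyclotomicField 3 ℚ)) 3 :=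
    IsCyclotomicExtension.zeta_spec 3 ℚ (CyclotomicField 3 ℚ)
  have hω : hζ.toInteger ^ 2 + hζ.toInteger + 1 = 0 := by
    have := hζ.toInteger_isPrimitiveRoot.geom_sum_eq_zero (by norm_num)
    simp only [Finset.sum_range_succ, Finset.sum_range_zero, pow_zero, pow_one] at this
    linear_combination this
  refine ⟨𝓞 (CyclotomicField 3 ℚ), inferInstance, inferInstance, IsCyclotomicExtension.Rat.three_pid (CyclotomicField 3 ℚ), inferInstance,
    hζ.toInteger, hω, ?_, ?_⟩
  · intro x
    have hx : x ∈ Algebra.adjoin ℤ {hζ.toInteger} := by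
      have h := (hζ.integralPowerBasis).adjoin_gen_eq_top
      rw [hζ.integralPowerBasis_gen] at h
      rw [h]; trivial
    induction hx using Algebra.adjoin_induction with
    | mem x hx => exact ⟨0, 1, by rw [Set.mem_singleton_iff.mp hx]; simp⟩
    | algebraMap r => exact ⟨r, 0, by simp⟩
    | add x y _ _ hx hy =>
      obtain ⟨c, d, rfl⟩ := hx
      obtain ⟨e, f, rfl⟩ := hy
      exact ⟨c + e, d + f, by push_cast; ring⟩
    | mul x y _ _ hx hy =>
      obtain ⟨c, d, rfl⟩ := hx
      obtain ⟨e, f, rfl⟩ := hy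
      refine ⟨c * e - d * f, c * f + d * e - d * f, ?_⟩
      push_cast
      linear_combination (d * f : 𝓞 (CyclotomicField 3 ℚ)) * hω
  · intro u
    have := IsCyclotomicExtension.Rat.Three.Units.mem hζ u
    simp only [List.mem_cons, List.not_mem_nil, or_false] at this
    rcases this with h | h | h | h | h | h
    · exact ⟨0, Or.inl (by simp [h])⟩
    · exact ⟨0, Or.inr (by simp [h])⟩
    · exact ⟨1, Or.inl (by simp [h])⟩
    · exact ⟨1, Or.inr (by simp [h])⟩
    · exact ⟨2, Or.inl (by simp [h])⟩
    · exact ⟨2, Or.inr (by simp [h])⟩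

/-- If `a` and `3b` are coprime and `a² + 3b²` is an odd cube, then `a + b√-3` is a cube
in `ℤ[√-3]`. -/
theorem exists_of_sq_add_three_mul_sq_eq_cube {a b m : ℤ} (hab : IsCoprime a b) (ha : ¬ 3 ∣ a)
    (hm : Odd m) (h : a ^ 2 + 3 * b ^ 2 = m ^ 3) :
    ∃ u v : ℤ, a = u * (u ^ 2 - 9 * v ^ 2) ∧ b = 3 * v * (u ^ 2 - v ^ 2) := by
  obtain ⟨R, _, _, _, _, ω, hω, hrep, hunit⟩ := exists_eisenstein_ring
  have hinj : ∀ c d : ℤ, (c : R) + d * ω = 0 → c = 0 ∧ d = 0 := by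
    intro c d hcd
    have h1 : ((c ^ 2 - c * d + d ^ 2 : ℤ) : R) = 0 := by
      push_cast
      linear_combination (c + d * (-1 - ω)) * hcd + (d ^ 2 : R) * hω
    have h2 : c ^ 2 - c * d + d ^ 2 = 0 := by exact_mod_cast h1
    have hd : d = 0 := by nlinarith [sq_nonneg (2 * c - d), sq_nonneg d]
    subst hd
    simpa using h2
  have hω3 : ω ^ 3 = 1 := by linear_combination (ω - 1) * hω
  -- Here `1 + 2ω` plays the role of `√-3`.
  have hfac : ((a : R) + b * (1 + 2 * ω)) * (a - b * (1 + 2 * ω)) = (m : R) ^ 3 := by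
    have : ((a ^ 2 + 3 * b ^ 2 : ℤ) : R) = m ^ 3 := by rw [h]; push_cast; ring
    push_cast at this
    linear_combination this - 4 * (b ^ 2 : R) * hω
  have hodd : Odd (a + b) := by
    by_contra hne
    rw [Int.not_odd_iff_even] at hne
    have : Even (a ^ 2 + 3 * b ^ 2) := by
      obtain ⟨k, hk⟩ := hne
      refine ⟨2 * k ^ 2 - 2 * k * b + 2 * b ^ 2, ?_⟩
      rw [show a = k + k - b by linarith]
      ring
    rw [h] at this
    exact (Int.not_even_iff_odd.mpr (hm.pow)) this
  have h6 : IsCoprime (6 : ℤ) (m ^ 3) := by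
    apply IsCoprime.pow_right
    have h2 : IsCoprime (2 : ℤ) m := by
      rw [Int.prime_two.coprime_iff_not_dvd]
      exact fun hd => (Int.not_even_iff_odd.mpr hm) (even_iff_two_dvd.mpr hd)
    have h3 : IsCoprime (3 : ℤ) m := by
      rw [Int.prime_three.coprime_iff_not_dvd]
      intro hd
      apply ha
      apply Int.prime_three.dvd_of_dvd_pow (n := 2)
      have : (3 : ℤ) ∣ m ^ 3 := dvd_pow hd (by norm_num)
      rw [← h] at this
      exact (Int.dvd_add_left (Dvd.intro _ rfl)).mp this
    simpa using h2.mul_left h3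
  -- A Bézout relation for `a, b` yields a combination of the two factors equal to 6, and their
  -- product `m³` is prime to 6.
  have hcop : IsCoprime ((a : R) + b * (1 + 2 * ω)) (a - b * (1 + 2 * ω)) := by
    obtain ⟨s, t, hst⟩ := hab
    obtain ⟨p, q, hpq⟩ := h6
    have hst' : (s : R) * a + t * b = 1 := by exact_mod_cast congrArg (Int.cast : ℤ → R) hst
    have hpq' : (p : R) * 6 + q * m ^ 3 = 1 := by exact_mod_cast congrArg (Int.cast : ℤ → R) hpq
    refine ⟨p * (3 * s - t * (1 + 2 * ω)) + q * (a - b * (1 + 2 * ω)),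
      p * (3 * s + t * (1 + 2 * ω)), ?_⟩
    linear_combination hpq' + q * hfac + 6 * p * hst' - 8 * p * t * b * hω
  obtain ⟨α, hα⟩ := exists_associated_pow_of_mul_eq_pow' hcop hfac
  obtain ⟨ε, hε⟩ := hα
  -- every element has an associate in `ℤ[√-3]`
  have hassoc : ∃ u v : ℤ, α ^ 3 = ((u : R) + v * (1 + 2 * ω)) ^ 3 := by
    obtain ⟨c, d, rfl⟩ := hrep α
    rcases Int.even_or_odd d with ⟨v, hv⟩ | hd
    · refine ⟨c - v, v, ?_⟩
      rw [hv]; push_cast; ring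
    rcases Int.even_or_odd c with ⟨v, hv⟩ | hc
    · refine ⟨d - c + v, -v, ?_⟩
      have : (((d - c + v : ℤ) : R) + ((-v : ℤ) : R) * (1 + 2 * ω)) = ω ^ 2 * (c + d * ω) := by
        rw [hv]; push_cast
        linear_combination (-2 * (v : R)) * hω - (d : R) * hω3
      rw [this, mul_pow, ← pow_mul, mul_comm 2 3, pow_mul, hω3]; ring
    · obtain ⟨v, hv⟩ := hc.sub_odd hd
      refine ⟨-d - v, v, ?_⟩
      have hv' : (c : R) = d + v + v := by
        have : c = d + (v + v) := by linarith
        rw [this]; push_cast; ring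
      have : (((-d - v : ℤ) : R) + ((v : ℤ) : R) * (1 + 2 * ω)) = ω * (c + d * ω) := by
        rw [hv']; push_cast
        linear_combination (-(d : R)) * hω
      rw [this, mul_pow, hω3]; ring
  obtain ⟨u, v, huv⟩ := hassoc
  -- The sign of the unit is a cube and is absorbed into `u, v`; only a power of `ω` remains.
  have key : ∃ (u v : ℤ) (k : Fin 3),
      (a : R) + b * (1 + 2 * ω) = ω ^ (k : ℕ) * ((u : R) + v * (1 + 2 * ω)) ^ 3 := by
    obtain ⟨k, hk | hk⟩ := hunit ε
    · exact ⟨u, v, k, by rw [← hε, hk, huv]; ring⟩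
    · exact ⟨-u, -v, k, by rw [← hε, hk, huv]; push_cast; ring⟩
  clear huv hε
  obtain ⟨u, v, k, hk⟩ := key
  set A : ℤ := u * (u ^ 2 - 9 * v ^ 2) with hA
  set B : ℤ := 3 * v * (u ^ 2 - v ^ 2) with hB
  have hcube : ((u : R) + v * (1 + 2 * ω)) ^ 3 = A + B * (1 + 2 * ω) := by
    rw [hA, hB]; push_cast
    linear_combination (12 * (u * v ^ 2 : R) + 4 * (v ^ 3 : R) * (1 + 2 * ω)) * hω
  rw [hcube] at hk
  refine ⟨u, v, ?_⟩
  -- For the powers `ω` and `ω²`, comparing coordinates would make `a + b` even.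
  fin_cases k
  · have := hinj (a + b - A - B) (2 * b - 2 * B) (by push_cast; simp at hk; linear_combination hk)
    omega
  · exfalso
    have := hinj (a + b + 2 * B) (2 * b - (A - B))
      (by push_cast; simp at hk; linear_combination hk + 2 * (B : R) * hω)
    obtain ⟨j, hj⟩ := hodd
    omega
  · exfalso
    have := hinj (a + b - (B - A)) (2 * b + A + B)
      (by push_cast; simp at hk; linear_combination hk + (A + B : R) * hω + 2 * (B : R) * (ω - 1) * hω)
    obtain ⟨j, hj⟩ := hodd
    omega

theorem Int.exists_cubes_of_mul_mul_eq_cube {p q r m : ℤ} (hpq : IsCoprime p q)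
    (hpr : IsCoprime p r) (hqr : IsCoprime q r) (h : p * q * r = m ^ 3) :
    ∃ x y z : ℤ, p = x ^ 3 ∧ q = y ^ 3 ∧ r = z ^ 3 := by
  have h3 : Odd 3 := by decide
  obtain ⟨d, hd⟩ := Int.eq_pow_of_mul_eq_pow_odd_left (hpr.mul_left hqr) h3 h
  obtain ⟨z, hz⟩ := Int.eq_pow_of_mul_eq_pow_odd_right (hpr.mul_left hqr) h3 h
  obtain ⟨x, hx⟩ := Int.eq_pow_of_mul_eq_pow_odd_left hpq h3 hd
  obtain ⟨y, hy⟩ := Int.eq_pow_of_mul_eq_pow_odd_right hpq h3 hd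
  exact ⟨x, y, z, hx, hy, hz⟩

theorem Int.isCoprime_sub_add_of_odd {u v : ℤ} (h : IsCoprime u v) (hodd : Odd (u + v)) :
    IsCoprime (u - v) (u + v) := by
  obtain ⟨s, t, hst⟩ := h
  obtain ⟨k, hk⟩ := hodd
  exact ⟨-k * (s - t), -k * (s + t) + 1, by linear_combination (-2 * k) * hst + hk⟩

theorem Int.isCoprime_sub_right {u v : ℤ} (h : IsCoprime u v) : IsCoprime u (u - v) := by
  obtain ⟨s, t, hst⟩ := h
  exact ⟨s + t, -t, by linear_combination hst⟩

theorem Int.isCoprime_add_right {u v : ℤ} (h : IsCoprime u v) : IsCoprime u (u + v) := by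
  obtain ⟨s, t, hst⟩ := h
  exact ⟨s - t, t, by linear_combination hst⟩

theorem Int.isCoprime_of_isCoprime_cube {u v : ℤ} (h : IsCoprime (u ^ 3) (v ^ 3)) :
    IsCoprime u v :=
  (IsCoprime.pow_iff (by norm_num) (by norm_num)).mp h

theorem Int.natAbs_lt_of_eq_mul {t z w : ℤ} (hz : z = t * w) (ht : t ≠ 0) (hw0 : w ≠ 0)
    (hw1 : w ≠ 1) (hw2 : w ≠ -1) : t.natAbs < z.natAbs := by
  rw [hz, Int.natAbs_mul]
  have h1 : 0 < t.natAbs := Int.natAbs_pos.mpr ht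
  have h2 : 2 ≤ w.natAbs := by omega
  nlinarith

theorem Int.cube_injective {a b : ℤ} (h : a ^ 3 = b ^ 3) : a = b :=
  (Odd.strictMono_pow (by decide : Odd 3)).injective h

/-- Euler: the only coprime solutions of `x³ + y³ = 2z³` with `z ≠ 0` have `x = y`. -/
theorem eq_of_cube_add_cube_eq_two_mul_cube {x y z : ℤ} (hxy : IsCoprime x y) (hz : z ≠ 0)
    (h : x ^ 3 + y ^ 3 = 2 * z ^ 3) : x = y := by
  induction hn : z.natAbs using Nat.strong_induction_on generalizing x y z with
  | _ n ih =>
  subst hn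
  by_contra hne
  have hsum : Even (x + y) := by
    have h1 : Even (x ^ 3 + y ^ 3) := ⟨z ^ 3, by linarith⟩
    rw [Int.even_add, Int.even_pow' (by norm_num), Int.even_pow' (by norm_num)] at h1
    exact Int.even_add.mpr h1
  obtain ⟨a, ha⟩ := hsum
  obtain ⟨b, hb⟩ : ∃ b, x = a + b := ⟨x - a, by ring⟩
  obtain rfl : y = a - b := by linarith
  subst hb
  have hb0 : b ≠ 0 := by rintro rfl; simp at hne
  have hmain : a * (a ^ 2 + 3 * b ^ 2) = z ^ 3 := by linarith
  have ha0 : a ≠ 0 := by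
    rintro rfl
    exact hz (by simpa using hmain.symm)
  have hab : IsCoprime a b := by
    obtain ⟨s, t, hst⟩ := hxy
    exact ⟨s + t, s - t, by linear_combination hst⟩
  have hodd : Odd (a + b) := by
    rw [← Int.not_even_iff_odd]
    intro he
    have he' : Even (a - b) := by rw [Int.even_sub]; exact Int.even_add.mp he
    have := hxy.isUnit_of_dvd' (even_iff_two_dvd.mp he) (even_iff_two_dvd.mp he')
    exact absurd (Int.isUnit_iff.mp this) (by norm_num)
  -- The factors of `a(a² + 3b²) = z³` are coprime unless `3 ∣ a`, in which case `a = 9d`, `z = 3w`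
  -- and `d(b² + 27d²) = w³`.
  by_cases h3 : (3 : ℤ) ∣ a
  · obtain ⟨c, rfl⟩ := h3
    have h3b : ¬ (3 : ℤ) ∣ b := by
      intro hb
      have := hab.isUnit_of_dvd' (Dvd.intro _ rfl) hb
      exact absurd (Int.isUnit_iff.mp this) (by norm_num)
    have h3z : (3 : ℤ) ∣ z := Int.prime_three.dvd_of_dvd_pow (n := 3)
      ⟨c * ((3 * c) ^ 2 + 3 * b ^ 2), by rw [← hmain]; ring⟩
    obtain ⟨w, rfl⟩ := h3z
    have hw : c * (3 * c ^ 2 + b ^ 2) = 3 * w ^ 3 := by linarith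
    have h3c : (3 : ℤ) ∣ c := by
      rcases Int.prime_three.dvd_or_dvd (⟨w ^ 3, hw⟩ : (3 : ℤ) ∣ _) with h | h
      · exact h
      · exact absurd (Int.prime_three.dvd_of_dvd_pow
          ((Int.dvd_add_right (Dvd.intro _ rfl)).mp h)) h3b
    obtain ⟨d, rfl⟩ := h3c
    have hw' : d * (b ^ 2 + 3 * (3 * d) ^ 2) = w ^ 3 := by linarith
    have hbd : IsCoprime b (3 * d) := by
      have : IsCoprime (3 * d * 3) b := by convert hab using 1; ring
      exact (IsCoprime.of_mul_left_left this).symm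
    have hcop : IsCoprime d (b ^ 2 + 3 * (3 * d) ^ 2) := by
      have h1 : IsCoprime d (b ^ 2) := (IsCoprime.of_mul_right_right hbd).symm.pow_right
      have := h1.add_mul_left_right (27 * d)
      rwa [show b ^ 2 + d * (27 * d) = b ^ 2 + 3 * (3 * d) ^ 2 by ring] at this
    obtain ⟨e, he⟩ := Int.eq_pow_of_mul_eq_pow_odd_left hcop (by decide) hw'
    obtain ⟨m, hm⟩ := Int.eq_pow_of_mul_eq_pow_odd_right hcop (by decide) hw'
    have hmodd : Odd m := by
      have : Odd (m ^ 3) := by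
        rw [← hm]
        obtain ⟨k, hk⟩ := hodd
        have hbk : b = 2 * k + 1 - 9 * d := by linarith
        rw [hbk]
        exact ⟨2 * k ^ 2 + 2 * k - 18 * k * d - 9 * d + 54 * d ^ 2, by ring⟩
      exact (Int.odd_pow' (by norm_num)).mp this
    obtain ⟨u, v, hu, hv⟩ := exists_of_sq_add_three_mul_sq_eq_cube hbd h3b hmodd hm
    have hd : v * (u - v) * (u + v) = e ^ 3 := by rw [← he]; linarith
    have huv : IsCoprime u v := by
      refine hbd.of_isCoprime_of_dvd_left ⟨_, hu⟩ |>.of_isCoprime_of_dvd_right ?_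
      exact ⟨3 * (u ^ 2 - v ^ 2), by rw [hv]; ring⟩
    have huvodd : Odd (u + v) := by
      rw [← Int.not_even_iff_odd]
      intro he
      have h1 : (2 : ℤ) ∣ b := by
        obtain ⟨k, hk⟩ := he
        refine ⟨u * (k * (u - v) - 4 * v ^ 2), ?_⟩
        rw [hu]; linear_combination (u * (u - v)) * hk
      have h2 : (2 : ℤ) ∣ 3 * d := by
        obtain ⟨k, hk⟩ := he
        refine ⟨3 * v * (k * (u - v)), ?_⟩
        rw [hv]; linear_combination (3 * v * (u - v)) * hk
      have := hbd.isUnit_of_dvd' h1 h2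
      exact absurd (Int.isUnit_iff.mp this) (by norm_num)
    -- The coprime factors `v`, `u - v`, `u + v` are cubes, and `(u + v) - (u - v) = 2v` is a
    -- smaller solution.
    obtain ⟨t, r, s, ht, hr, hs⟩ := Int.exists_cubes_of_mul_mul_eq_cube
      (by have := Int.isCoprime_sub_right huv.symm
          simpa using this.neg_right) (by simpa [add_comm] using Int.isCoprime_add_right huv.symm)
      (Int.isCoprime_sub_add_of_odd huv huvodd) hd
    have hd0 : d ≠ 0 := by rintro rfl; simp at ha0
    have ht0 : t ≠ 0 := by
      rintro rfl
      apply hd0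
      have : v = 0 := by simpa using ht
      rw [this] at hv; linarith
    have hrs : IsCoprime s (-r) := by
      apply IsCoprime.neg_right
      apply IsCoprime.symm
      apply Int.isCoprime_of_isCoprime_cube
      rw [← hr, ← hs]
      exact Int.isCoprime_sub_add_of_odd huv huvodd
    have hz' : (3 * w) = t * (3 * (r * s * m)) := by
      have h1 : w ^ 3 = (t * r * s * m) ^ 3 := by
        rw [← hw', hm, show d = v * (u - v) * (u + v) by linarith, hr, hs, ht]; ring
      rw [Int.cube_injective h1]; ring
    have hlt := Int.natAbs_lt_of_eq_mul hz' ht0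
      (by intro h0; rw [h0, mul_zero] at hz'; exact hz hz') (by omega) (by omega)
    have := ih _ hlt hrs ht0 (by linear_combination hr - hs + 2 * ht) rfl
    have : u = 0 := by
      have h1 : u + v = -(u - v) := by rw [hs, hr, this]; ring
      linarith
    rw [this] at hu
    exact hb0 (by rw [hu]; ring)
  · have hcop : IsCoprime a (a ^ 2 + 3 * b ^ 2) := by
      have h1 : IsCoprime a (3 * b ^ 2) := IsCoprime.mul_right
        ((Int.prime_three.coprime_iff_not_dvd.mpr h3).symm) hab.pow_right
      have := h1.add_mul_left_right a
      rwa [show 3 * b ^ 2 + a * a = a ^ 2 + 3 * b ^ 2 by ring] at this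
    obtain ⟨e, he⟩ := Int.eq_pow_of_mul_eq_pow_odd_left hcop (by decide) hmain
    obtain ⟨m, hm⟩ := Int.eq_pow_of_mul_eq_pow_odd_right hcop (by decide) hmain
    have hmodd : Odd m := by
      have : Odd (m ^ 3) := by
        rw [← hm]
        obtain ⟨k, hk⟩ := hodd
        have hbk : a = 2 * k + 1 - b := by linarith
        rw [hbk]
        exact ⟨2 * k ^ 2 + 2 * k - 2 * k * b - b + 2 * b ^ 2, by ring⟩
      exact (Int.odd_pow' (by norm_num)).mp this
    obtain ⟨u, v, hu, hv⟩ := exists_of_sq_add_three_mul_sq_eq_cube hab h3 hmodd hm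
    have hd : u * (u - 3 * v) * (u + 3 * v) = e ^ 3 := by rw [← he]; linarith
    have huv : IsCoprime u (3 * v) := by
      refine hab.of_isCoprime_of_dvd_left ⟨_, hu⟩ |>.of_isCoprime_of_dvd_right ⟨_, hv⟩
    have huvodd : Odd (u + 3 * v) := by
      rw [← Int.not_even_iff_odd]
      intro he
      have h1 : (2 : ℤ) ∣ a := by
        obtain ⟨k, hk⟩ := he
        refine ⟨u * (k * (u - 3 * v)), ?_⟩
        rw [hu]; linear_combination (u * (u - 3 * v)) * hk
      have h2 : (2 : ℤ) ∣ b := by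
        obtain ⟨k, hk⟩ := he
        refine ⟨3 * v * (k * (u - 3 * v) + 4 * v ^ 2), ?_⟩
        rw [hv]; linear_combination (3 * v * (u - 3 * v)) * hk
      have := hab.isUnit_of_dvd' h1 h2
      exact absurd (Int.isUnit_iff.mp this) (by norm_num)
    -- Now `(u - 3v) + (u + 3v) = 2u` is the smaller solution.
    obtain ⟨t, r, s, ht, hr, hs⟩ := Int.exists_cubes_of_mul_mul_eq_cube
      (Int.isCoprime_sub_right huv) (Int.isCoprime_add_right huv)
      (Int.isCoprime_sub_add_of_odd huv huvodd) hd
    have ht0 : t ≠ 0 := by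
      rintro rfl
      apply ha0
      have : u = 0 := by simpa using ht
      rw [hu, this]; ring
    have hrs : IsCoprime r s := by
      apply Int.isCoprime_of_isCoprime_cube
      rw [← hr, ← hs]
      exact Int.isCoprime_sub_add_of_odd huv huvodd
    have hz' : z = t * (r * s * m) := by
      have h1 : z ^ 3 = (t * r * s * m) ^ 3 := by
        rw [← hmain, hm, show a = u * (u - 3 * v) * (u + 3 * v) by linarith, hr, hs, ht]; ring
      rw [Int.cube_injective h1]; ring
    have hv0 : v ≠ 0 := by
      rintro rfl
      exact hb0 (by rw [hv]; ring)
    -- Strict descent: if `r, s = ±1`, then `u ± 3v = ±1` forces `u = 0` or `v = 0`.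
    have hunit : ¬ IsUnit (r * s * m) := by
      intro hun
      have hrsu := isUnit_of_mul_isUnit_left hun
      have hr1 := Int.isUnit_iff.mp (isUnit_of_mul_isUnit_left hrsu)
      have hs1 := Int.isUnit_iff.mp (isUnit_of_mul_isUnit_right hrsu)
      rcases hr1 with rfl | rfl <;> rcases hs1 with rfl | rfl <;> norm_num at hr hs
      · exact hv0 (by omega)
      · exact ha0 (by rw [hu, show u = 0 by omega]; ring)
      · exact ha0 (by rw [hu, show u = 0 by omega]; ring)
      · exact hv0 (by omega)
    rw [Int.isUnit_iff, not_or] at hunit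
    have hlt := Int.natAbs_lt_of_eq_mul hz' ht0
      (by intro h0; rw [h0, mul_zero] at hz'; exact hz hz') hunit.1 hunit.2
    have := ih _ hlt hrs ht0 (by linear_combination 2 * ht - hr - hs) rfl
    apply hv0
    have h1 : u - 3 * v = u + 3 * v := by rw [hr, hs, this]
    linarith

/-- The equation `4AB(A+B) = T³` has only the obvious rational solutions. -/
theorem Rat.of_four_mul_mul_add_eq_cube {A B T : ℚ} (hA : A ≠ 0) (hB : B ≠ 0) (hAB : A + B ≠ 0)
    (h : 4 * A * B * (A + B) = T ^ 3) : A = B ∨ A = -2 * B ∨ B = -2 * A := by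
  obtain ⟨a, b, k, hab, hk, rfl, rfl⟩ : ∃ (a b : ℤ) (k : ℚ), IsCoprime a b ∧ k ≠ 0 ∧
      A = a * k ∧ B = b * k := by
    refine ⟨(A / B).num, (A / B).den, B / (A / B).den, ?_, ?_, ?_, ?_⟩
    · exact Int.isCoprime_iff_gcd_eq_one.mpr (A / B).reduced
    · have := (A / B).den_nz
      positivity
    · have := Rat.num_div_den (A / B)
      rw [mul_div_left_comm, this]
      field_simp
    · have := (A / B).den_nz
      push_cast
      field_simp
  have ha0 : a ≠ 0 := by rintro rfl; simp at hA
  have hb0 : b ≠ 0 := by rintro rfl; simp at hB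
  have hc0 : a + b ≠ 0 := by
    intro h0
    apply hAB
    rw [← add_mul, ← Int.cast_add, h0]; simp
  have hcube : ((4 * a * b * (a + b) : ℤ) : ℚ) = (T / k) ^ 3 := by
    rw [div_pow, ← h]
    push_cast
    field_simp
  obtain ⟨t, ht⟩ : ∃ t : ℤ, (t : ℚ) = T / k := by
    have hi : IsIntegral ℤ (T / k) := by
      apply IsIntegral.of_pow (n := 3) (by norm_num)
      rw [← hcube]
      exact isIntegral_algebraMap (R := ℤ) (A := ℚ)
    exact IsIntegrallyClosed.isIntegral_iff.mp hi
  have hint : 4 * a * b * (a + b) = t ^ 3 := by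
    rw [← ht] at hcube
    exact_mod_cast hcube
  have ht2 : (2 : ℤ) ∣ t := Int.prime_two.dvd_of_dvd_pow (n := 3)
    ⟨2 * a * b * (a + b), by rw [← hint]; ring⟩
  obtain ⟨s, rfl⟩ := ht2
  have hint : a * b * (a + b) = 2 * s ^ 3 := by linarith
  have hac := Int.isCoprime_add_right hab
  have hbc : IsCoprime b (a + b) := by simpa [add_comm] using Int.isCoprime_add_right hab.symm
  have hcast : ∀ x y : ℤ, x = -2 * y → (x : ℚ) * k = -2 * (y * k) := by
    intro x y hxy
    rw [hxy]; push_cast; ring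
  -- One of the pairwise coprime `a`, `b`, `a + b` is even. Once it is halved, all three are cubes,
  -- and their additive relation is Euler's equation.
  rcases Int.even_or_odd a with ⟨a', ha⟩ | hodda
  · right; left
    apply hcast
    have hda : a' ∣ a := ⟨2, by linarith⟩
    obtain ⟨x, y, w, hx, hy, hw⟩ := Int.exists_cubes_of_mul_mul_eq_cube (m := s)
      (hab.of_isCoprime_of_dvd_left hda) (hac.of_isCoprime_of_dvd_left hda) hbc
      (by have := congrArg (· * b * (a + b)) ha; linarith)
    have hx0 : x ≠ 0 := by rintro rfl; apply ha0; rw [ha, hx]; ring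
    have : w = -y := by
      refine eq_of_cube_add_cube_eq_two_mul_cube (z := x) ?_ hx0 ?_
      · apply IsCoprime.neg_right
        apply Int.isCoprime_of_isCoprime_cube
        rw [← hy, ← hw]; exact hbc.symm
      · linear_combination -hw + hy + 2 * hx + ha
    rw [this] at hw
    linear_combination hw + hy
  rcases Int.even_or_odd b with ⟨b', hb⟩ | hoddb
  · right; right
    apply hcast
    have hdb : b' ∣ b := ⟨2, by linarith⟩
    obtain ⟨x, y, w, hx, hy, hw⟩ := Int.exists_cubes_of_mul_mul_eq_cube (m := s)
      (hab.of_isCoprime_of_dvd_right hdb) hac (hbc.of_isCoprime_of_dvd_left hdb)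
      (by have := congrArg (a * · * (a + b)) hb; linarith)
    have hy0 : y ≠ 0 := by rintro rfl; apply hb0; rw [hb, hy]; ring
    have : w = -x := by
      refine eq_of_cube_add_cube_eq_two_mul_cube (z := y) ?_ hy0 ?_
      · apply IsCoprime.neg_right
        apply Int.isCoprime_of_isCoprime_cube
        rw [← hx, ← hw]; exact hac.symm
      · linear_combination -hw + hx + 2 * hy + hb
    rw [this] at hw
    linear_combination hw + hx
  · left
    obtain ⟨c', hc⟩ := hodda.add_odd hoddb
    have hdc : c' ∣ a + b := ⟨2, by linarith⟩
    obtain ⟨x, y, w, hx, hy, hw⟩ := Int.exists_cubes_of_mul_mul_eq_cube (m := s)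
      hab (hac.of_isCoprime_of_dvd_right hdc) (hbc.of_isCoprime_of_dvd_right hdc)
      (by have := congrArg (a * b * ·) hc; linarith)
    have hw0 : w ≠ 0 := by rintro rfl; apply hc0; rw [hc, hw]; ring
    have : x = y := by
      refine eq_of_cube_add_cube_eq_two_mul_cube (z := w) ?_ hw0 ?_
      · apply Int.isCoprime_of_isCoprime_cube
        rw [← hx, ← hy]; exact hab
      · linear_combination -hx - hy + 2 * hw + hc
    rw [hx, hy, this]

end EulerCubes

/-! ### Points of order 3 and the 3-division polynomial -/

section ThreeTorsion

open WeierstrassCurve Polynomial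

theorem WeierstrassCurve.eval_Ψ₃ {R : Type*} [CommRing R] (W : WeierstrassCurve R) (x : R) :
    W.Ψ₃.eval x = 3 * x ^ 4 + W.b₂ * x ^ 3 + 3 * W.b₄ * x ^ 2 + 3 * W.b₆ * x + W.b₈ := by
  simp [WeierstrassCurve.Ψ₃]

namespace WeierstrassCurve.Affine

variable {F : Type*} [Field F] {W : WeierstrassCurve F}

/-- The numerator of the tangent slope, the `2`-division polynomial and the `3`-division
polynomial are related on the curve. -/
theorem Ψ₃_relation {x y : F} (h : W.toAffine.Equation x y) :
    (3 * x ^ 2 + 2 * W.a₂ * x + W.a₄ - W.a₁ * y) ^ 2 +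
      W.a₁ * (3 * x ^ 2 + 2 * W.a₂ * x + W.a₄ - W.a₁ * y) * (2 * y + W.a₁ * x + W.a₃) -
      (W.a₂ + 3 * x) * (2 * y + W.a₁ * x + W.a₃) ^ 2 + W.Ψ₃.eval x = 0 := by
  rw [equation_iff] at h
  rw [eval_Ψ₃]
  simp only [b₂, b₄, b₆, b₈]
  linear_combination (-(W.a₁ ^ 2 + 4 * W.a₂ + 12 * x)) * h

/-- At a 2-torsion point `Ψ₃_relation` reads `Ψ₃ = -N²`, with `N` minus the partial derivative in
`x`; a zero would make the point singular. -/
theorem Ψ₃_ne_zero_of_eq_negY {x y : F} (h : W.toAffine.Nonsingular x y)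
    (hy : y = W.toAffine.negY x y) : W.Ψ₃.eval x ≠ 0 := by
  intro h0
  have hrel := Ψ₃_relation h.1
  rw [nonsingular_iff] at h
  have hψ : 2 * y + W.a₁ * x + W.a₃ = 0 := by
    rw [negY] at hy; linear_combination hy
  rw [hψ, h0] at hrel
  have hN : 3 * x ^ 2 + 2 * W.a₂ * x + W.a₄ - W.a₁ * y = 0 := by
    apply pow_eq_zero_iff (two_ne_zero) |>.mp
    linear_combination hrel
  rcases h.2 with h1 | h1
  · exact h1 (by linear_combination -hN)
  · exact h1 hy

/-- The `x`-coordinate of a point, with junk value `1` at the origin. -/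
noncomputable def Point.xCoord (P : W.toAffine.Point) : F := P.xRep 0

theorem Point.xCoord_eq_iff {P Q : W.toAffine.Point} (hP : P ≠ 0) (hQ : Q ≠ 0) :
    P.xCoord = Q.xCoord ↔ P = Q ∨ P = -Q := by
  rw [← Point.xRep_eq_xRep_iff]
  match P, Q, hP, hQ with
  | .some x y h, .some x' y' h', _, _ => simp [Point.xCoord]

variable [DecidableEq F]

/-- Dividing `Ψ₃_relation` by `d²`, where `d = 2y + a₁x + a₃`, gives `x(2P) - x(P) = -Ψ₃(x)/d²`. -/
theorem addX_self_eq_iff {x y : F} (h : W.toAffine.Equation x y) (hy : y ≠ W.toAffine.negY x y) :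
    W.toAffine.addX x x (W.toAffine.slope x x y y) = x ↔ W.Ψ₃.eval x = 0 := by
  have hψ : 2 * y + W.a₁ * x + W.a₃ ≠ 0 := by
    intro h0
    apply hy
    rw [negY]; linear_combination h0
  have hψ' : y - W.toAffine.negY x y = 2 * y + W.a₁ * x + W.a₃ := by rw [negY]; ring
  have hrel := Ψ₃_relation h
  rw [slope_of_Y_ne rfl hy, hψ', addX]
  set N := 3 * x ^ 2 + 2 * W.a₂ * x + W.a₄ - W.a₁ * y
  set d := 2 * y + W.a₁ * x + W.a₃
  have key : (N / d) ^ 2 + W.a₁ * (N / d) - W.a₂ - x - x - x = -(W.Ψ₃.eval x) / d ^ 2 := by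
    field_simp
    linear_combination hrel
  constructor
  · intro hx
    have : -(W.Ψ₃.eval x) / d ^ 2 = 0 := by rw [← key]; linear_combination hx
    rw [div_eq_zero_iff, neg_eq_zero] at this
    exact this.resolve_right (pow_ne_zero 2 hψ)
  · intro h0
    rw [h0, neg_zero, zero_div] at key
    linear_combination key

/-- An affine point is `3`-torsion if and only if its `x`-coordinate is a root of the
`3`-division polynomial. -/
theorem Point.three_smul_some_eq_zero_iff {x y : F} (h : W.toAffine.Nonsingular x y) :
    3 • Point.some x y h = 0 ↔ W.Ψ₃.eval x = 0 := by
  have h3 : 3 • Point.some x y h = Point.some x y h + Point.some x y h + Point.some x y h := by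
    rw [succ_nsmul, two_nsmul]
  by_cases hy : y = W.toAffine.negY x y
  · rw [h3, Point.add_self_of_Y_eq hy, zero_add]
    exact iff_of_false (Point.some_ne_zero h) (Ψ₃_ne_zero_of_eq_negY h hy)
  · rw [h3, ← addX_self_eq_iff h.1 hy, add_eq_zero_iff_eq_neg]
    -- Equal abscissae mean `2P = ±P`; since `P ≠ 0`, only `2P = -P` is possible.
    have hne : Point.some x y h + Point.some x y h ≠ Point.some x y h := by
      simp
    rw [← or_iff_right (b := _ = -Point.some x y h) hne, ← Point.xRep_eq_xRep_iff, Point.add_self_of_Y_ne hy,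
      Point.xRep_some, Point.xRep_some]
    simp

theorem Point.Ψ₃_eval_xCoord {P : W.toAffine.Point} (hP : P ≠ 0) (h : 3 • P = 0) :
    W.Ψ₃.eval P.xCoord = 0 := by
  match P, hP with
  | .some x y hxy, _ => exact (Point.three_smul_some_eq_zero_iff hxy).mp h

theorem Point.xCoord_ne_of_three_torsion {e f : W.toAffine.Point} (he3 : 3 • e = 0)
    (hf3 : 3 • f = 0) (he : e ≠ 0) (hf : f ≠ 0) (h1 : f ≠ e) (h2 : f ≠ -e) :
    e.xCoord ≠ f.xCoord ∧ e.xCoord ≠ (e + f).xCoord ∧ e.xCoord ≠ (e - f).xCoord ∧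
    f.xCoord ≠ (e + f).xCoord ∧ f.xCoord ≠ (e - f).xCoord ∧ (e + f).xCoord ≠ (e - f).xCoord := by
  have hs : e + f ≠ 0 := fun h => h2 (eq_neg_of_add_eq_zero_right h)
  have hd : e - f ≠ 0 := fun h => h1 (sub_eq_zero.mp h).symm
  refine ⟨?_, ?_, ?_, ?_, ?_, ?_⟩ <;> rw [Ne, Point.xCoord_eq_iff (by assumption) (by assumption)]
    <;> rintro (h | h)
  · exact h1 h.symm
  · exact h2 (by linear_combination (norm := module) (1 : ℤ) • h)
  · exact hf (by linear_combination (norm := module) (-1 : ℤ) • h)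
  · exact h1 (by linear_combination (norm := module) (1 : ℤ) • h - (1 : ℤ) • he3)
  · exact hf (by linear_combination (norm := module) (1 : ℤ) • h)
  · exact h2 (by linear_combination (norm := module) (-1 : ℤ) • h + (1 : ℤ) • he3)
  · exact he (by linear_combination (norm := module) (-1 : ℤ) • h)
  · exact h1 (by linear_combination (norm := module) (-1 : ℤ) • h + (1 : ℤ) • hf3)
  · exact h2 (by linear_combination (norm := module) (-1 : ℤ) • h + (1 : ℤ) • hf3)
  · exact he (by linear_combination (norm := module) (1 : ℤ) • h)
  · exact hf (by linear_combination (norm := module) (-1 : ℤ) • h + (1 : ℤ) • hf3)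
  · exact he (by linear_combination (norm := module) (-1 : ℤ) • h + (1 : ℤ) • he3)

end WeierstrassCurve.Affine

end ThreeTorsion

/-! ### Discriminant, resolvent and factorization of `Ψ₃` -/

section Quartic

open Polynomial

/-- Successive divided differences. This serves to identify coefficients of polynomials from their
values at four points. -/
theorem cubic_coeffs_eq_zero {F : Type*} [Field F] {a b c d x₁ x₂ x₃ x₄ : F}
    (h12 : x₁ ≠ x₂) (h13 : x₁ ≠ x₃) (h14 : x₁ ≠ x₄) (h23 : x₂ ≠ x₃) (h24 : x₂ ≠ x₄)
    (h34 : x₃ ≠ x₄) (h1 : a * x₁ ^ 3 + b * x₁ ^ 2 + c * x₁ + d = 0)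
    (h2 : a * x₂ ^ 3 + b * x₂ ^ 2 + c * x₂ + d = 0)
    (h3 : a * x₃ ^ 3 + b * x₃ ^ 2 + c * x₃ + d = 0)
    (h4 : a * x₄ ^ 3 + b * x₄ ^ 2 + c * x₄ + d = 0) : a = 0 ∧ b = 0 ∧ c = 0 ∧ d = 0 := by
  have k2 : a * (x₁ ^ 2 + x₁ * x₂ + x₂ ^ 2) + b * (x₁ + x₂) + c = 0 :=
    mul_left_cancel₀ (sub_ne_zero.mpr h12) (by linear_combination h1 - h2)
  have k3 : a * (x₁ ^ 2 + x₁ * x₃ + x₃ ^ 2) + b * (x₁ + x₃) + c = 0 :=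
    mul_left_cancel₀ (sub_ne_zero.mpr h13) (by linear_combination h1 - h3)
  have k4 : a * (x₁ ^ 2 + x₁ * x₄ + x₄ ^ 2) + b * (x₁ + x₄) + c = 0 :=
    mul_left_cancel₀ (sub_ne_zero.mpr h14) (by linear_combination h1 - h4)
  have l3 : a * (x₁ + x₂ + x₃) + b = 0 :=
    mul_left_cancel₀ (sub_ne_zero.mpr h23) (by linear_combination k2 - k3)
  have l4 : a * (x₁ + x₂ + x₄) + b = 0 :=
    mul_left_cancel₀ (sub_ne_zero.mpr h24) (by linear_combination k2 - k4)
  have ha : a = 0 := mul_left_cancel₀ (sub_ne_zero.mpr h34) (by linear_combination l3 - l4)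
  subst ha
  have hb : b = 0 := by linear_combination l3
  subst hb
  have hc : c = 0 := by linear_combination k2
  subst hc
  exact ⟨rfl, rfl, rfl, by linear_combination h1⟩

namespace WeierstrassCurve

variable {F : Type*} [Field F] (W : WeierstrassCurve F)

/-- `x₁, x₂, x₃, x₄` are the roots of the `3`-division polynomial, with multiplicity: Vieta's
formulas hold. -/
def HasΨ₃Roots (x₁ x₂ x₃ x₄ : F) : Prop :=
    W.b₂ = -3 * (x₁ + x₂ + x₃ + x₄) ∧
    W.b₄ = x₁ * x₂ + x₁ * x₃ + x₁ * x₄ + x₂ * x₃ + x₂ * x₄ + x₃ * x₄ ∧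
    W.b₆ = -(x₁ * x₂ * x₃ + x₁ * x₂ * x₄ + x₁ * x₃ * x₄ + x₂ * x₃ * x₄) ∧
    W.b₈ = 3 * (x₁ * x₂ * x₃ * x₄)

/-- Vieta's formulas for the `3`-division polynomial. -/
theorem vieta_Ψ₃ [CharZero F] {x₁ x₂ x₃ x₄ : F}
    (h12 : x₁ ≠ x₂) (h13 : x₁ ≠ x₃) (h14 : x₁ ≠ x₄) (h23 : x₂ ≠ x₃) (h24 : x₂ ≠ x₄)
    (h34 : x₃ ≠ x₄) (h1 : W.Ψ₃.eval x₁ = 0) (h2 : W.Ψ₃.eval x₂ = 0) (h3 : W.Ψ₃.eval x₃ = 0)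
    (h4 : W.Ψ₃.eval x₄ = 0) :
    W.HasΨ₃Roots x₁ x₂ x₃ x₄ := by
  rw [eval_Ψ₃] at h1 h2 h3 h4
  obtain ⟨k2, k4, k6, k8⟩ := cubic_coeffs_eq_zero
    (a := W.b₂ + 3 * (x₁ + x₂ + x₃ + x₄))
    (b := 3 * W.b₄ - 3 * (x₁ * x₂ + x₁ * x₃ + x₁ * x₄ + x₂ * x₃ + x₂ * x₄ + x₃ * x₄))
    (c := 3 * W.b₆ + 3 * (x₁ * x₂ * x₃ + x₁ * x₂ * x₄ + x₁ * x₃ * x₄ + x₂ * x₃ * x₄))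
    (d := W.b₈ - 3 * (x₁ * x₂ * x₃ * x₄)) h12 h13 h14 h23 h24 h34
    (by linear_combination h1) (by linear_combination h2) (by linear_combination h3)
    (by linear_combination h4)
  refine ⟨by linear_combination k2, by linear_combination k4 / 3, by linear_combination k6 / 3,
    by linear_combination k8⟩

theorem eval_Ψ₃_eq {x₁ x₂ x₃ x₄ : F}
    (h : W.HasΨ₃Roots x₁ x₂ x₃ x₄) (x : F) :
    W.Ψ₃.eval x = 3 * ((x - x₁) * (x - x₂) * (x - x₃) * (x - x₄)) := by
  obtain ⟨k2, k4, k6, k8⟩ := h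
  rw [eval_Ψ₃, k2, k4, k6, k8]
  ring

/-- The discriminant of the `3`-division polynomial is `-27 Δ²`. -/
theorem sq_prod_sub_roots_Ψ₃ {x₁ x₂ x₃ x₄ : F}
    (h : W.HasΨ₃Roots x₁ x₂ x₃ x₄) :
    (9 * ((x₁ - x₂) * (x₁ - x₃) * (x₁ - x₄) * (x₂ - x₃) * (x₂ - x₄) * (x₃ - x₄))) ^ 2 =
      -3 * W.Δ ^ 2 := by
  have hrel := W.b_relation
  obtain ⟨k2, k4, k6, k8⟩ := h
  rw [k2, k4, k6, k8] at hrel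
  rw [Δ, k2, k4, k6, k8]
  set e₁ := x₁ + x₂ + x₃ + x₄ with he₁
  set e₂ := x₁ * x₂ + x₁ * x₃ + x₁ * x₄ + x₂ * x₃ + x₂ * x₄ + x₃ * x₄ with he₂
  set e₃ := x₁ * x₂ * x₃ + x₁ * x₂ * x₄ + x₁ * x₃ * x₄ + x₂ * x₃ * x₄ with he₃
  set e₄ := x₁ * x₂ * x₃ * x₄ with he₄
  have hdisc : 27 *
      ((x₁ - x₂) * (x₁ - x₃) * (x₁ - x₄) * (x₂ - x₃) * (x₂ - x₄) * (x₃ - x₄)) ^ 2 =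
      4 * (e₂ ^ 2 - 3 * e₁ * e₃ + 12 * e₄) ^ 3 -
      (2 * e₂ ^ 3 - 9 * e₁ * e₂ * e₃ + 27 * e₃ ^ 2 + 27 * e₁ ^ 2 * e₄ - 72 * e₂ * e₄) ^ 2 := by
    rw [he₁, he₂, he₃, he₄]; ring
  -- With `I`, `J` the invariants of the quartic, 27 times its discriminant is `4I³ - J²`. The
  -- relation between the `bᵢ` says `I = 0`, and `J = -Δ`.
  have hI : e₂ ^ 2 - 3 * e₁ * e₃ + 12 * e₄ = 0 := by linear_combination hrel
  have hJ : 2 * e₂ ^ 3 - 9 * e₁ * e₂ * e₃ + 27 * e₃ ^ 2 + 27 * e₁ ^ 2 * e₄ - 72 * e₂ * e₄ =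
      8 * e₂ ^ 3 - 27 * e₁ * e₂ * e₃ + 27 * e₃ ^ 2 + 27 * e₁ ^ 2 * e₄ := by
    linear_combination (-6 * e₂) * hI
  rw [hI, hJ] at hdisc
  linear_combination 3 * hdisc

/-- The resolvent cubic of the `3`-division polynomial is a pure cubic. -/
theorem resolvent_Ψ₃ {x₁ x₂ x₃ x₄ : F}
    (h : W.HasΨ₃Roots x₁ x₂ x₃ x₄) :
    (W.b₄ - 3 * (x₁ * x₃ + x₂ * x₄)) ^ 3 = W.Δ := by
  have hrel := W.b_relation
  obtain ⟨k2, k4, k6, k8⟩ := h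
  rw [k2, k4, k6, k8] at hrel
  rw [Δ, k2, k4, k6, k8]
  set e₁ := x₁ + x₂ + x₃ + x₄ with he₁
  set e₂ := x₁ * x₂ + x₁ * x₃ + x₁ * x₄ + x₂ * x₃ + x₂ * x₄ + x₃ * x₄ with he₂
  set e₃ := x₁ * x₂ * x₃ + x₁ * x₂ * x₄ + x₁ * x₃ * x₄ + x₂ * x₃ * x₄ with he₃
  set e₄ := x₁ * x₂ * x₃ * x₄ with he₄
  -- The resolvent `y³ - 3Iy - J`, which becomes pure because `I = 0`.
  have hres : (3 * (x₁ * x₃ + x₂ * x₄) - e₂) ^ 3 -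
      3 * (e₂ ^ 2 - 3 * e₁ * e₃ + 12 * e₄) * (3 * (x₁ * x₃ + x₂ * x₄) - e₂) -
      (2 * e₂ ^ 3 - 9 * e₁ * e₂ * e₃ + 27 * e₃ ^ 2 + 27 * e₁ ^ 2 * e₄ - 72 * e₂ * e₄) = 0 := by
    rw [he₁, he₂, he₃, he₄]; ring
  have hI : e₂ ^ 2 - 3 * e₁ * e₃ + 12 * e₄ = 0 := by linear_combination hrel
  rw [hI] at hres
  linear_combination -hres + 6 * e₂ * hI

/-- The `3`-division polynomial of a nonsingular curve is not the fourth power of a linear form. -/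
theorem exists_ne_roots_Ψ₃ [CharZero F] [IsAlgClosed F] (hΔ : W.Δ ≠ 0) :
    ∃ x y : F, x ≠ y ∧ W.Ψ₃.eval x = 0 ∧ W.Ψ₃.eval y = 0 := by
  have h3 : (3 : F) ≠ 0 := by norm_num
  have hdeg := W.natDegree_Ψ₃ h3
  have hlead := W.leadingCoeff_Ψ₃ h3
  have hsplit := IsAlgClosed.splits W.Ψ₃
  have hcard := hsplit.natDegree_eq_card_roots
  have hprod := hsplit.eq_prod_roots
  have hne : W.Ψ₃ ≠ 0 := by
    intro h0; rw [h0] at hdeg; simp at hdeg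
  by_contra! hall
  obtain ⟨r, hr⟩ : ∃ r, r ∈ W.Ψ₃.roots := by
    apply Multiset.card_pos_iff_exists_mem.mp; omega
  have hr0 := (mem_roots'.mp hr).2
  have hrep : W.Ψ₃.roots = Multiset.replicate 4 r := by
    rw [Multiset.eq_replicate]
    refine ⟨by omega, fun b hb => ?_⟩
    by_contra hbr
    exact hall b r hbr (mem_roots'.mp hb).2 hr0
  have hev : ∀ x, W.Ψ₃.eval x = 3 * (x - r) ^ 4 := by
    intro x
    conv_lhs => rw [hprod, hrep, hlead]
    simp
    ring
  have hc := fun x => (W.eval_Ψ₃ x).symm.trans (hev x)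
  obtain ⟨k2, k4, k6, k8⟩ := cubic_coeffs_eq_zero (x₁ := (0 : F)) (x₂ := 1) (x₃ := 2) (x₄ := 3)
    (a := W.b₂ + 12 * r) (b := 3 * W.b₄ - 18 * r ^ 2) (c := 3 * W.b₆ + 12 * r ^ 3)
    (d := W.b₈ - 3 * r ^ 4) (by norm_num) (by norm_num) (by norm_num) (by norm_num) (by norm_num)
    (by norm_num) (by linear_combination hc 0) (by linear_combination hc 1)
    (by linear_combination hc 2) (by linear_combination hc 3)
  apply hΔ
  have j2 : W.b₂ = -12 * r := by linear_combination k2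
  have j4 : W.b₄ = 6 * r ^ 2 := by linear_combination k4 / 3
  have j6 : W.b₆ = -4 * r ^ 3 := by linear_combination k6 / 3
  have j8 : W.b₈ = 3 * r ^ 4 := by linear_combination k8
  rw [Δ, j2, j4, j6, j8]
  ring

end WeierstrassCurve

theorem Rat.not_sq_eq_three (q : ℚ) : q ^ 2 ≠ 3 := by
  intro h
  have : IsSquare (3 : ℚ) := ⟨q, by rw [← h]; ring⟩
  rw [show (3 : ℚ) = ((3 : ℕ) : ℚ) by norm_num, Rat.isSquare_natCast_iff] at this
  obtain ⟨k, hk⟩ := this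
  have : k ≤ 3 := by nlinarith
  interval_cases k <;> omega

/-- The polynomial `3X⁴ - 6D²X² - D⁴` is not a product of two rational quadratics; this is
stated for its translate by `a`. -/
theorem not_product_of_quadratics {a D s t m n : ℚ} (hD : D ≠ 0) (h1 : s + t = 4 * a)
    (h2 : m + n + s * t = 2 * (3 * a ^ 2 - D ^ 2)) (h3 : s * n + t * m = 4 * a * (a ^ 2 - D ^ 2))
    (h4 : 3 * (m * n) = 3 * a ^ 4 - 6 * a ^ 2 * D ^ 2 - D ^ 4) : False := by
  -- Recentring at `a` turns the factors into `X² - sX + m` and `X² + sX + n`. Then `s(n - m) = 0`: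
  -- `s = 0` would make 3 a rational square, and `m = n` gives `3m² = -D⁴`.
  obtain ⟨s, rfl⟩ : ∃ s', s = s' + 2 * a := ⟨s - 2 * a, by ring⟩
  obtain rfl : t = -s + 2 * a := by linarith
  obtain ⟨m, rfl⟩ : ∃ m', m = m' + a * s + a ^ 2 := ⟨m - a * s - a ^ 2, by ring⟩
  obtain ⟨n, rfl⟩ : ∃ n', n = n' - a * s + a ^ 2 := ⟨n + a * s - a ^ 2, by ring⟩
  have k2 : m + n - s ^ 2 = -2 * D ^ 2 := by linear_combination h2
  have k3 : s * (n - m) = 0 := by linear_combination h3 - 2 * a * k2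
  have k4 : 3 * (m * n) = -D ^ 4 := by
    linear_combination h4 - 3 * a * k3 - 3 * a ^ 2 * k2
  rcases mul_eq_zero.mp k3 with hs | hmn
  · subst hs
    have hk : 3 * (m - n) ^ 2 = 16 * D ^ 4 := by
      linear_combination 3 * (m + n - 2 * D ^ 2) * k2 - 4 * k4
    have hne : m - n ≠ 0 := by
      intro h0
      rw [h0] at hk
      have : D ^ 4 = 0 := by linarith
      exact hD (pow_eq_zero_iff (by norm_num) |>.mp this)
    apply Rat.not_sq_eq_three (4 * D ^ 2 / (m - n))
    field_simp
    linear_combination -hk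
  · have : n = m := by linarith
    subst this
    have : 0 < D ^ 4 := by positivity
    nlinarith [sq_nonneg n]

end Quartic

/-! ### Planes over `𝔽₃` that are not absolutely irreducible -/

section RepresentationTheory

open scoped TensorProduct

theorem ZMod.three_cases (a : ZMod 3) : a = 0 ∨ a = 1 ∨ a = -1 := by
  revert a; decide

theorem Submodule.exists_generator_of_finrank_eq_two {L M : Type*} [Field L] [AddCommGroup M]
    [Module L M] (hM : Module.finrank L M = 2) (W : Submodule L M) (hbot : W ≠ ⊥) (htop : W ≠ ⊤) :
    ∃ w ∈ W, w ≠ 0 ∧ ∀ v ∈ W, ∃ c : L, v = c • w := by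
  have : Module.Finite L M := Module.finite_of_finrank_pos (by omega)
  have h1 : Module.finrank L W = 1 := by
    have hlt := Submodule.finrank_lt htop
    have hpos := Submodule.one_le_finrank_iff.mpr hbot
    omega
  obtain ⟨⟨w, hw⟩, hw0, hspan⟩ := finrank_eq_one_iff'.mp h1
  refine ⟨w, hw, fun h0 => hw0 (by ext; exact h0), fun v hv => ?_⟩
  obtain ⟨c, hc⟩ := hspan ⟨v, hv⟩
  exact ⟨c, (congrArg Subtype.val hc).symm⟩

/-- A two-dimensional representation which is not absolutely irreducible has an eigenvector with
coordinates in an algebraic closure. -/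
theorem ModThree.exists_eigenvector_of_not_isAbsolutelyIrreducible {k G V : Type*} [Field k]
    [Group G] [AddCommGroup V] [Module k V] (b : Module.Basis (Fin 2) k V)
    (ρ : Representation k G V) (h : ¬ ModThree.IsAbsolutelyIrreducible ρ) :
    ∃ u v : AlgebraicClosure k, (u ≠ 0 ∨ v ≠ 0) ∧ ∀ g, ∃ p q r s : k,
      ρ g (b 0) = p • b 0 + r • b 1 ∧ ρ g (b 1) = q • b 0 + s • b 1 ∧
      ∃ c : AlgebraicClosure k, algebraMap k _ p * u + algebraMap k _ q * v = c * u ∧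
        algebraMap k _ r * u + algebraMap k _ s * v = c * v := by
  set L := AlgebraicClosure k
  let B : Module.Basis (Fin 2) L (L ⊗[k] V) := b.baseChange L
  have hB : ∀ i, B i = 1 ⊗ₜ b i := fun i => by simp [B]
  have hfr : Module.finrank L (L ⊗[k] V) = 2 := by
    rw [Module.finrank_eq_card_basis B]; simp
  have : Module.Finite L (L ⊗[k] V) := Module.Finite.of_basis B
  have hnt : Nontrivial (L ⊗[k] V) := Module.nontrivial_of_finrank_pos (R := L) (by omega)
  set ρ' := ModThree.extendScalars L ρ with hρ'
  obtain ⟨σ, hbot, htop⟩ : ∃ σ : Subrepresentation ρ', σ.toSubmodule ≠ ⊥ ∧ σ.toSubmodule ≠ ⊤ := by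
    by_contra! hall
    apply h
    have : Nontrivial (Subrepresentation ρ') := by
      refine ⟨⊥, ⊤, fun heq => ?_⟩
      have := congrArg Subrepresentation.toSubmodule heq
      exact (bot_ne_top : (⊥ : Submodule L (L ⊗[k] V)) ≠ ⊤) this
    refine { eq_bot_or_eq_top := fun σ => ?_ }
    by_cases hσ : σ.toSubmodule = ⊥
    · left; exact Subrepresentation.toSubmodule_injective hσ
    · right; exact Subrepresentation.toSubmodule_injective (hall σ hσ)
  obtain ⟨w, hw, hw0', hspan⟩ :=
    Submodule.exists_generator_of_finrank_eq_two hfr σ.toSubmodule hbot htop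
  have hwB : w = B.repr w 0 • B 0 + B.repr w 1 • B 1 := by
    conv_lhs => rw [← B.sum_repr w]
    rw [Fin.sum_univ_two]
  refine ⟨B.repr w 0, B.repr w 1, ?_, fun g => ?_⟩
  · by_contra! h0
    rw [h0.1, h0.2] at hwB
    exact hw0' (by simpa using hwB)
  · have hexp : ∀ v : V, v = b.repr v 0 • b 0 + b.repr v 1 • b 1 := fun v => by
      conv_lhs => rw [← b.sum_repr v]
      rw [Fin.sum_univ_two]
    refine ⟨b.repr (ρ g (b 0)) 0, b.repr (ρ g (b 1)) 0, b.repr (ρ g (b 0)) 1,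
      b.repr (ρ g (b 1)) 1, hexp _, hexp _, ?_⟩
    obtain ⟨c, hc⟩ := hspan (ρ' g w) (σ.apply_mem_toSubmodule g hw)
    have hc' : c • w = ρ' g w := hc.symm
    have himg : ∀ i, ρ' g (B i) = algebraMap k L (b.repr (ρ g (b i)) 0) • B 0 +
        algebraMap k L (b.repr (ρ g (b i)) 1) • B 1 := by
      intro i
      have : ρ' g (B i) = 1 ⊗ₜ ρ g (b i) := by
        rw [hB]; exact LinearMap.baseChange_tmul _ _ _
      rw [this, hexp (ρ g (b i)), hB, hB, TensorProduct.tmul_add, TensorProduct.tmul_smul,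
        TensorProduct.tmul_smul]
      simp
    rw [hwB, map_add, map_smul, map_smul, himg, himg] at hc'
    refine ⟨c, ?_, ?_⟩
    · have := congrArg (fun z => B.repr z 0) hc'
      simp [-algebraMap_smul] at this
      linear_combination -this
    · have := congrArg (fun z => B.repr z 1) hc'
      simp [-algebraMap_smul] at this
      linear_combination -this

/-- A representation on a plane over `𝔽₃` which is not absolutely irreducible either preserves a
line, or acts through multiplications by elements of `𝔽₉`. -/
theorem ModThree.of_not_isAbsolutelyIrreducible {G V : Type*} [Group G] [AddCommGroup V]
    [Module (ZMod 3) V] (hV : Module.finrank (ZMod 3) V = 2)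
    (ρ : Representation (ZMod 3) G V) (h : ¬ ModThree.IsAbsolutelyIrreducible ρ) :
    (∃ v : V, v ≠ 0 ∧ ∀ g, ρ g v = v ∨ ρ g v = -v) ∨
    ∃ e f : V, e ≠ 0 ∧ f ≠ 0 ∧ f ≠ e ∧ f ≠ -e ∧ ∀ g, ∃ a c : ZMod 3,
      ρ g e = a • e + c • f ∧ ρ g f = -c • e + a • f := by
  have : Module.Finite (ZMod 3) V := Module.finite_of_finrank_pos (by omega)
  let b : Module.Basis (Fin 2) (ZMod 3) V := Module.finBasisOfFinrankEq _ _ hV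
  obtain ⟨u, v, huv, hρ⟩ := exists_eigenvector_of_not_isAbsolutelyIrreducible b ρ h
  set ι := algebraMap (ZMod 3) (AlgebraicClosure (ZMod 3)) with hι
  have hinj : Function.Injective ι := ι.injective
  have hline : ∀ w : V, w ≠ 0 → (∀ g, ∃ a : ZMod 3, ρ g w = a • w) →
      ∃ v : V, v ≠ 0 ∧ ∀ g, ρ g v = v ∨ ρ g v = -v := by
    intro w hw hg
    refine ⟨w, hw, fun g => ?_⟩
    obtain ⟨a, ha⟩ := hg g
    rcases ZMod.three_cases a with rfl | rfl | rfl
    · exfalso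
      apply hw
      have : ρ g⁻¹ (ρ g w) = w := by
        rw [← Module.End.mul_apply, ← map_mul]; simp
      rw [← this, ha]; simp
    · left; simpa using ha
    · right; simpa using ha
  have hb0 : b 0 ≠ 0 := b.ne_zero 0
  have hb1 : b 1 ≠ 0 := b.ne_zero 1
  by_cases hu : u = 0
  · left
    have hv : v ≠ 0 := huv.resolve_left (not_not.mpr hu)
    refine hline (b 1) hb1 fun g => ?_
    obtain ⟨p, q, r, s, -, h1, c, hc, -⟩ := hρ g
    have hq : q = 0 := by
      apply hinj
      rw [hu, mul_zero, mul_zero, zero_add] at hc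
      simpa using (mul_eq_zero.mp hc).resolve_right hv
    exact ⟨s, by rw [h1, hq]; simp⟩
  -- The eigenvector is proportional to `b 0 + t • b 1`. If `t ∈ 𝔽₃` it spans a rational line;
  -- otherwise `1, t` are independent over `𝔽₃`.
  set t := v / u with ht
  have hvt : v = t * u := by rw [ht]; field_simp
  have hrel : ∀ g, ∃ p q r s : ZMod 3, ρ g (b 0) = p • b 0 + r • b 1 ∧
      ρ g (b 1) = q • b 0 + s • b 1 ∧ ι r + ι s * t = ι p * t + ι q * t ^ 2 := by
    intro g
    obtain ⟨p, q, r, s, h0, h1, c, hc0, hc1⟩ := hρ g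
    refine ⟨p, q, r, s, h0, h1, ?_⟩
    rw [hvt] at hc0 hc1
    have hc : c = ι p + ι q * t := mul_right_cancel₀ hu (by linear_combination -hc0)
    apply mul_right_cancel₀ hu
    rw [hc] at hc1
    linear_combination hc1
  by_cases htr : ∃ τ : ZMod 3, t = ι τ
  · left
    obtain ⟨τ, hτ⟩ := htr
    refine hline (b 0 + τ • b 1) ?_ fun g => ?_
    · intro h0
      have := congrArg (fun z => b.repr z 0) h0
      simp at this
    · obtain ⟨p, q, r, s, h0, h1, heq⟩ := hrel g
      have heq' : r + s * τ = p * τ + q * τ ^ 2 := by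
        apply hinj
        rw [hτ] at heq
        simpa using heq
      refine ⟨p + q * τ, ?_⟩
      rw [map_add, map_smul, h0, h1]
      calc p • b 0 + r • b 1 + τ • (q • b 0 + s • b 1)
          = (p + q * τ) • b 0 + (r + s * τ) • b 1 := by module
        _ = (p + q * τ) • (b 0 + τ • b 1) := by rw [heq']; module
  push Not at htr
  have hlin : ∀ x y : ZMod 3, ι x + ι y * t = 0 → x = 0 ∧ y = 0 := by
    intro x y hxy
    have hy : y = 0 := by
      by_contra hy
      apply htr (-x / y)
      rw [map_div₀, map_neg]
      have : ι y ≠ 0 := by simpa using hy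
      field_simp
      linear_combination hxy
    subst hy
    simpa using hxy
  have h3 : (3 : AlgebraicClosure (ZMod 3)) = 0 := by
    have := map_ofNat ι 3
    rw [← this, show (OfNat.ofNat 3 : ZMod 3) = 0 from rfl, map_zero]
  have h3' : (3 : ZMod 3) = 0 := rfl
  by_cases hscal : ∀ g, ∃ p : ZMod 3, ρ g (b 0) = p • b 0
  · left
    exact hline (b 0) hb0 hscal
  right
  -- a quadratic equation satisfied by `t`
  obtain ⟨m, n, hmn⟩ : ∃ m n : ZMod 3, t ^ 2 + ι m * t + ι n = 0 := by
    push Not at hscal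
    obtain ⟨g, hg⟩ := hscal
    obtain ⟨p, q, r, s, h0, h1, heq⟩ := hrel g
    have hq : q ≠ 0 := by
      rintro rfl
      obtain ⟨hr, -⟩ := hlin r (s - p) (by rw [map_zero] at heq; rw [map_sub]; linear_combination heq)
      apply hg p
      rw [h0, hr]; simp
    have hq' : ι q ≠ 0 := by simpa using hq
    refine ⟨(p - s) / q, -r / q, ?_⟩
    rw [map_div₀, map_div₀, map_sub, map_neg]
    field_simp
    linear_combination -heq
  -- Completing the square, with `-2 = 1`. As `t` is not in `𝔽₃`, the right side is the nonsquare
  -- `-1`.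
  have hs2 : (t - ι m) ^ 2 = ι (m ^ 2 - n) := by
    rw [map_sub, map_pow]
    linear_combination hmn - ι m * t * h3
  have hs : (t - ι m) ^ 2 = -1 := by
    rcases ZMod.three_cases (m ^ 2 - n) with h0 | h0 | h0
    · rw [h0, map_zero] at hs2
      exact absurd (sub_eq_zero.mp (pow_eq_zero_iff two_ne_zero |>.mp hs2)) (htr m)
    · rw [h0, map_one] at hs2
      rcases mul_self_eq_one_iff.mp ((sq _).symm.trans hs2) with h1 | h1
      · exact absurd (by rw [map_add, map_one]; linear_combination h1) (htr (m + 1))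
      · exact absurd (by rw [map_sub, map_one]; linear_combination h1) (htr (m - 1))
    · rw [hs2, h0, map_neg, map_one]
  -- In this basis the eigenvector is `e + i f` with `i = t - m` and `i² = -1`. A matrix over `𝔽₃`
  -- having it as eigenvector has the form `a + cJ`, where `J e = f` and `J f = -e`.
  refine ⟨b 0 + m • b 1, b 1, ?_, hb1, ?_, ?_, fun g => ?_⟩
  · intro h0
    have := congrArg (fun z => b.repr z 0) h0
    simp at this
  · intro h0
    have := congrArg (fun z => b.repr z 0) h0
    simp at this
  · intro h0
    have := congrArg (fun z => b.repr z 0) h0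
    simp at this
  · obtain ⟨p, q, r, s, h0, h1, heq⟩ := hrel g
    obtain ⟨k1, k2⟩ := hlin (r + q + q * m ^ 2) (s - p - 2 * q * m) (by
      simp only [map_add, map_mul, map_pow, map_sub, map_ofNat]
      linear_combination heq + ι q * hs)
    have hd : s - m * q = p + m * q := by linear_combination k2
    have hc : r + m * s - m * (p + m * q) = -q := by linear_combination k1 + m * k2
    refine ⟨p + m * q, -q, ?_, ?_⟩
    · rw [map_add, map_smul, h0, h1, ← hc]
      module
    · rw [h1, ← hd]
      module

end RepresentationTheory

/-! ### Point counts over `𝔽_p` and roots of `Ψ₃` in `ℚ_p` -/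

section Reduction

open WeierstrassCurve Polynomial

namespace WeierstrassCurve

section FiniteField

variable {k : Type*} [Field k] (W : WeierstrassCurve k)

/-- The quadratic twist of a Weierstrass curve by `d`, in characteristic different from `2`. -/
def quadraticTwist (d : k) : WeierstrassCurve k :=
  ⟨0, d * W.b₂ / 4, 0, d ^ 2 * W.b₄ / 2, d ^ 3 * W.b₆ / 4⟩

variable {W}

theorem quadraticTwist_b₂ (h2 : (2 : k) ≠ 0) (d : k) :
    (W.quadraticTwist d).b₂ = d * W.b₂ := by
  have h4 : (4 : k) ≠ 0 := by convert mul_ne_zero h2 h2 using 1; norm_num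
  simp only [quadraticTwist]
  rw [WeierstrassCurve.b₂]
  field_simp
  ring

theorem quadraticTwist_b₄ (h2 : (2 : k) ≠ 0) (d : k) :
    (W.quadraticTwist d).b₄ = d ^ 2 * W.b₄ := by
  simp only [quadraticTwist]
  rw [WeierstrassCurve.b₄]
  field_simp
  ring

theorem quadraticTwist_b₆ (h2 : (2 : k) ≠ 0) (d : k) :
    (W.quadraticTwist d).b₆ = d ^ 3 * W.b₆ := by
  have h4 : (4 : k) ≠ 0 := by convert mul_ne_zero h2 h2 using 1; norm_num
  simp only [quadraticTwist]
  rw [WeierstrassCurve.b₆]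
  field_simp
  ring

theorem quadraticTwist_b₈ (h2 : (2 : k) ≠ 0) (d : k) :
    (W.quadraticTwist d).b₈ = d ^ 4 * W.b₈ := by
  have h4 : (4 : k) ≠ 0 := by convert mul_ne_zero h2 h2 using 1; norm_num
  apply mul_left_cancel₀ h4
  rw [b_relation, quadraticTwist_b₂ h2, quadraticTwist_b₄ h2, quadraticTwist_b₆ h2]
  linear_combination -d ^ 4 * W.b_relation

theorem quadraticTwist_Δ (h2 : (2 : k) ≠ 0) (d : k) :
    (W.quadraticTwist d).Δ = d ^ 6 * W.Δ := by
  rw [Δ, Δ, quadraticTwist_b₂ h2, quadraticTwist_b₄ h2, quadraticTwist_b₆ h2, quadraticTwist_b₈ h2]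
  ring

theorem eval_Ψ₃_quadraticTwist (h2 : (2 : k) ≠ 0) (d x : k) :
    (W.quadraticTwist d).Ψ₃.eval (d * x) = d ^ 4 * W.Ψ₃.eval x := by
  rw [eval_Ψ₃, eval_Ψ₃, quadraticTwist_b₂ h2, quadraticTwist_b₄ h2, quadraticTwist_b₆ h2,
    quadraticTwist_b₈ h2]
  ring

theorem eval_Ψ₂Sq (x : k) :
    W.Ψ₂Sq.eval x = 4 * x ^ 3 + W.b₂ * x ^ 2 + 2 * W.b₄ * x + W.b₆ := by
  simp [Ψ₂Sq]

theorem eval_Ψ₂Sq_quadraticTwist (h2 : (2 : k) ≠ 0) (d x : k) :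
    (W.quadraticTwist d).Ψ₂Sq.eval (d * x) = d ^ 3 * W.Ψ₂Sq.eval x := by
  rw [eval_Ψ₂Sq, eval_Ψ₂Sq, quadraticTwist_b₂ h2, quadraticTwist_b₄ h2, quadraticTwist_b₆ h2]
  ring

theorem equation_iff_sq_eq_Ψ₂Sq (h2 : (2 : k) ≠ 0) (x y : k) :
    W.toAffine.Equation x y ↔ (2 * y + W.a₁ * x + W.a₃) ^ 2 = W.Ψ₂Sq.eval x := by
  have h4 : (4 : k) ≠ 0 := by convert mul_ne_zero h2 h2 using 1; norm_num
  rw [Affine.equation_iff, eval_Ψ₂Sq, b₂, b₄, b₆]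
  constructor
  · intro h
    linear_combination 4 * h
  · intro h
    apply mul_left_cancel₀ h4
    linear_combination h

/-- The nonsingular affine points, fibred over their `x`-coordinates. -/
def affinePointsEquiv (h2 : (2 : k) ≠ 0) (hΔ : W.Δ ≠ 0) :
    {xy : k × k // W.toAffine.Nonsingular xy.1 xy.2} ≃
      Σ x : k, {z : k // z ^ 2 = W.Ψ₂Sq.eval x} where
  toFun p := ⟨p.1.1, 2 * p.1.2 + W.a₁ * p.1.1 + W.a₃, (equation_iff_sq_eq_Ψ₂Sq h2 _ _).mp p.2.1⟩
  invFun q := ⟨(q.1, (q.2.1 - W.a₁ * q.1 - W.a₃) / 2), by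
    rw [← W.toAffine.equation_iff_nonsingular_of_Δ_ne_zero hΔ, equation_iff_sq_eq_Ψ₂Sq h2]
    refine Eq.trans ?_ q.2.2
    congr 1
    field_simp
    ring⟩
  left_inv p := by
    ext
    · rfl
    · simp only
      field_simp
      ring
  right_inv q := by
    obtain ⟨x, z, hz⟩ := q
    simp only [Sigma.mk.injEq, heq_eq_eq, Subtype.mk.injEq, true_and]
    field_simp
    ring

/-- The value `z` supplies a rational ordinate above `x`, hence a rational point of order 3. -/
theorem three_dvd_card_point [DecidableEq k] (h2 : (2 : k) ≠ 0) (hΔ : W.Δ ≠ 0) {x z : k}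
    (hx : W.Ψ₃.eval x = 0) (hz : z ^ 2 = W.Ψ₂Sq.eval x) : 3 ∣ Nat.card W.toAffine.Point := by
  have heq : W.toAffine.Equation x ((z - W.a₁ * x - W.a₃) / 2) := by
    rw [equation_iff_sq_eq_Ψ₂Sq h2, ← hz]
    congr 1
    field_simp
    ring
  have hns := (W.toAffine.equation_iff_nonsingular_of_Δ_ne_zero hΔ).mp heq
  have h3 := (Affine.Point.three_smul_some_eq_zero_iff hns).mpr hx
  have hord : addOrderOf (Affine.Point.some _ _ hns) = 3 :=
    addOrderOf_eq_prime h3 (Affine.Point.some_ne_zero hns)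
  rw [← hord]
  exact addOrderOf_dvd_natCard _

variable [Fintype k] [DecidableEq k]

theorem card_point_eq_sum (hk : ringChar k ≠ 2) (hΔ : W.Δ ≠ 0) :
    (Nat.card W.toAffine.Point : ℤ) = 1 + ∑ x : k, (quadraticChar k (W.Ψ₂Sq.eval x) + 1) := by
  have h2 : (2 : k) ≠ 0 := Ring.two_ne_zero hk
  rw [Nat.card_congr (Affine.nonsingularPointEquiv W.toAffine)]
  have h1 : Nat.card (WithZero {xy : k × k // W.toAffine.Nonsingular xy.1 xy.2}) =
      Nat.card {xy : k × k // W.toAffine.Nonsingular xy.1 xy.2} + 1 := Finite.card_option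
  rw [h1, Nat.card_congr (affinePointsEquiv h2 hΔ), Nat.card_sigma]
  push_cast
  rw [add_comm]
  congr 1
  refine Finset.sum_congr rfl fun x _ => ?_
  rw [← quadraticChar_card_sqrts hk]
  simp [Nat.card_eq_fintype_card, Fintype.card_subtype]

/-- The fibre over `x` has `1 + χ(Ψ₂Sq(x))` points. The bijection `x ↦ dx` matches it with a fibre
of the twist, where the character is multiplied by `χ(d)³ = -1`. -/
theorem card_point_add_card_point_quadraticTwist (hk : ringChar k ≠ 2) (hΔ : W.Δ ≠ 0) {d : k}
    (hd : ¬ IsSquare d) :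
    (Nat.card W.toAffine.Point : ℤ) + Nat.card (W.quadraticTwist d).toAffine.Point =
      2 * Fintype.card k + 2 := by
  have h2 : (2 : k) ≠ 0 := Ring.two_ne_zero hk
  have hd0 : d ≠ 0 := by rintro rfl; exact hd (IsSquare.zero)
  have hΔ' : (W.quadraticTwist d).Δ ≠ 0 := by
    rw [quadraticTwist_Δ h2]; exact mul_ne_zero (pow_ne_zero 6 hd0) hΔ
  rw [card_point_eq_sum hk hΔ, card_point_eq_sum hk hΔ',
    ← Equiv.sum_comp (Equiv.mulLeft₀ d hd0)
      (fun x => quadraticChar k ((W.quadraticTwist d).Ψ₂Sq.eval x) + 1)]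
  have hχ : quadraticChar k d = -1 := quadraticChar_neg_one_iff_not_isSquare.mpr hd
  have : ∀ x, quadraticChar k ((W.quadraticTwist d).Ψ₂Sq.eval (Equiv.mulLeft₀ d hd0 x)) + 1 =
      2 - (quadraticChar k (W.Ψ₂Sq.eval x) + 1) := by
    intro x
    rw [Equiv.mulLeft₀_apply, eval_Ψ₂Sq_quadraticTwist h2, map_mul, map_pow, hχ]
    ring
  rw [Finset.sum_congr rfl fun x _ => this x, Finset.sum_sub_distrib]
  simp
  ring

/-- A curve over a finite field with `q ≡ 1 mod 3` elements whose trace of Frobenius is divisible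
by `3` has no `3`-torsion point with rational `x`-coordinate. -/
theorem eval_Ψ₃_ne_zero_of_three_dvd (hk : ringChar k ≠ 2) (hΔ : W.Δ ≠ 0)
    (hq : Fintype.card k ≡ 1 [MOD 3])
    (ha : (3 : ℤ) ∣ Fintype.card k + 1 - Nat.card W.toAffine.Point) (x : k) :
    W.Ψ₃.eval x ≠ 0 := by
  intro hx
  have h2 : (2 : k) ≠ 0 := Ring.two_ne_zero hk
  unfold Nat.ModEq at hq
  by_cases hsq : IsSquare (W.Ψ₂Sq.eval x)
  · obtain ⟨z, hz⟩ := hsq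
    have := three_dvd_card_point h2 hΔ hx (z := z) (by rw [hz, sq])
    omega
  -- Twisting by this `d` turns the value at `dx` into `d³ · d = (d²)²`. Yet both curves have `2 mod
  -- 3` points.
  · set d := W.Ψ₂Sq.eval x with hd
    have hd0 : d ≠ 0 := by intro h0; rw [h0] at hsq; exact hsq (IsSquare.zero)
    have hΔ' : (W.quadraticTwist d).Δ ≠ 0 := by
      rw [quadraticTwist_Δ h2]; exact mul_ne_zero (pow_ne_zero 6 hd0) hΔ
    have := three_dvd_card_point h2 hΔ' (x := d * x) (z := d ^ 2)
      (by rw [eval_Ψ₃_quadraticTwist h2, hx, mul_zero])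
      (by rw [eval_Ψ₂Sq_quadraticTwist h2, ← hd]; ring)
    have hsum := card_point_add_card_point_quadraticTwist hk hΔ hsq
    omega

end FiniteField

theorem eval_Ψ₃_variableChange {F : Type*} [Field F] (W : WeierstrassCurve F)
    (C : VariableChange F) (x : F) :
    (C • W).Ψ₃.eval ((C.u⁻¹ : Fˣ) ^ 2 * (x - C.r)) = (C.u⁻¹ : Fˣ) ^ 8 * W.Ψ₃.eval x := by
  rw [eval_Ψ₃, eval_Ψ₃, variableChange_b₂, variableChange_b₄, variableChange_b₆,
    variableChange_b₈]
  ring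

end WeierstrassCurve

variable (E : WeierstrassCurve ℚ) (p : ℕ) [Fact p.Prime]

theorem PadicInt.ringChar_residueField :
    ringChar (IsLocalRing.ResidueField ℤ_[p]) = p := by
  have := charP_of_injective_ringHom (f := (PadicInt.residueField (p := p)).symm.toRingHom)
    (PadicInt.residueField (p := p)).symm.injective p
  exact ringChar.eq _ p

theorem PadicInt.isUnit_three (hp : p ≠ 3) : IsUnit (3 : ℤ_[p]) := by
  have h : IsUnit ((3 : ℕ) : ℤ_[p]) := by
    rw [PadicInt.isUnit_iff, PadicInt.norm_natCast_eq_one_iff]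
    exact (Nat.coprime_primes Fact.out Nat.prime_three).mpr hp
  exact_mod_cast h

/-- Under the hypotheses at `p`, no `3`-torsion point has its `x`-coordinate in `ℚ_p`. -/
theorem ModThree.eval_Ψ₃_padic_ne_zero (hp : p ≡ 1 [MOD 3])
    (hgood : ModThree.HasGoodReductionAt E p) (ha : (3 : ℤ) ∣ ModThree.traceOfFrobenius E p)
    (x : ℚ_[p]) : (E.baseChange ℚ_[p]).Ψ₃.eval x ≠ 0 := by
  intro hx
  have hp3 : p ≠ 3 := by rintro rfl; revert hp; decide
  have hp2 : p ≠ 2 := by rintro rfl; revert hp; decide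
  set M := ModThree.localMinimalModel E p with hM
  obtain ⟨C, hC⟩ : ∃ C : VariableChange ℚ_[p], M = C • (E.baseChange ℚ_[p]) := ⟨_, rfl⟩
  obtain ⟨ξ, hξ⟩ : ∃ ξ, M.Ψ₃.eval ξ = 0 :=
    ⟨_, by rw [hC, eval_Ψ₃_variableChange, hx, mul_zero]⟩
  set I := M.integralModel ℤ_[p] with hI
  have hMI : I.map (algebraMap ℤ_[p] ℚ_[p]) = M := baseChange_integralModel_eq ℤ_[p] M
  have hroot : aeval ξ I.Ψ₃ = 0 := by
    rw [aeval_def, ← eval_map, ← map_Ψ₃, hMI, hξ]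
  -- The leading coefficient 3 of `Ψ₃` is a unit in `ℤ_p`.
  have h3 : IsIntegral ℤ_[p] ξ := by
    have h := isIntegral_leadingCoeff_smul I.Ψ₃ ξ hroot
    rw [leadingCoeff_Ψ₃ I (by exact_mod_cast (PadicInt.isUnit_three p hp3).ne_zero)] at h
    obtain ⟨u, hu⟩ := PadicInt.isUnit_three p hp3
    have h' := h.smul (↑u⁻¹ : ℤ_[p])
    rwa [smul_smul, ← hu, Units.inv_mul, one_smul] at h'
  obtain ⟨η, rfl⟩ := IsIntegrallyClosed.isIntegral_iff.mp h3
  have hη : I.Ψ₃.eval η = 0 := by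
    rw [aeval_algebraMap_apply] at hroot
    simpa using hroot
  have hred : (M.reduction ℤ_[p]).Ψ₃.eval (IsLocalRing.residue ℤ_[p] η) = 0 := by
    rw [reduction, map_Ψ₃, eval_map, eval₂_at_apply, ← hI, hη, map_zero]
  classical
  let e := (PadicInt.residueField (p := p)).toEquiv
  let _ : Fintype (IsLocalRing.ResidueField ℤ_[p]) := Fintype.ofEquiv _ e.symm
  have hcard : Fintype.card (IsLocalRing.ResidueField ℤ_[p]) = p := by
    rw [Fintype.card_congr e, ZMod.card]
  have hell := (hasGoodReduction_iff_isElliptic_reduction ℤ_[p]).mp hgood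
  refine eval_Ψ₃_ne_zero_of_three_dvd (W := M.reduction ℤ_[p]) ?_ ?_ ?_ ?_ _ hred
  · rw [PadicInt.ringChar_residueField]; exact hp2
  · exact hell.isUnit.ne_zero
  · rw [hcard]; exact hp
  · rw [hcard]; exact ha

end Reduction

/-! ### The field `ℚ(√-3)` and its embedding in `ℚ_p` -/

section QuadraticField

open ModThree Polynomial

namespace ModThree

instance : Algebra.IsAlgebraic ℚ QBar := AlgebraicClosure.isAlgebraic ℚ

instance : IsAlgClosure ℚ QBar := ⟨inferInstance, inferInstance⟩

instance : IsGalois ℚ QBar where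
  to_normal := IsAlgClosure.normal ℚ QBar

theorem lStar_three : ((lStar 3 : ℤ) : QBar) = -3 := by
  norm_num [lStar]

theorem mem_quadraticField_of_sq_eq {x : QBar} (hx : x ^ 2 = -3) : x ∈ quadraticField 3 :=
  IntermediateField.subset_adjoin _ _ (by rw [Set.mem_ofPred_eq, lStar_three, hx])

theorem exists_rat_of_mem_quadraticField {r : QBar} (hr : r ^ 2 = -3) {z : QBar}
    (hz : z ∈ quadraticField 3) : ∃ a b : ℚ, z = a + b * r := by
  induction hz using IntermediateField.adjoin_induction with
  | mem x hx =>
    rw [Set.mem_ofPred_eq, lStar_three, ← hr] at hx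
    rcases sq_eq_sq_iff_eq_or_eq_neg.mp hx with rfl | rfl
    · exact ⟨0, 1, by simp⟩
    · exact ⟨0, -1, by simp⟩
  | algebraMap q => exact ⟨q, 0, by simp⟩
  | add x y _ _ hx hy =>
    obtain ⟨a, b, rfl⟩ := hx
    obtain ⟨c, d, rfl⟩ := hy
    exact ⟨a + c, b + d, by push_cast; ring⟩
  | inv x _ hx =>
    obtain ⟨a, b, rfl⟩ := hx
    by_cases h0 : a ^ 2 + 3 * b ^ 2 = 0
    · have ha : a = 0 := by nlinarith [sq_nonneg a, sq_nonneg b]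
      have hb : b = 0 := by subst ha; nlinarith [sq_nonneg b]
      exact ⟨0, 0, by simp [ha, hb]⟩
    · refine ⟨a / (a ^ 2 + 3 * b ^ 2), -b / (a ^ 2 + 3 * b ^ 2), ?_⟩
      have h0' : (a : QBar) ^ 2 + 3 * (b : QBar) ^ 2 ≠ 0 := by exact_mod_cast h0
      apply inv_eq_of_mul_eq_one_right
      push_cast
      rw [div_eq_mul_inv, div_eq_mul_inv]
      have hinv := mul_inv_cancel₀ h0'
      set i := ((a : QBar) ^ 2 + 3 * (b : QBar) ^ 2)⁻¹
      linear_combination hinv - (b : QBar) ^ 2 * i * hr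
  | mul x y _ _ hx hy =>
    obtain ⟨a, b, rfl⟩ := hx
    obtain ⟨c, d, rfl⟩ := hy
    refine ⟨a * c - 3 * b * d, a * d + b * c, ?_⟩
    push_cast
    linear_combination (b * d : QBar) * hr

theorem mem_fixingSubgroup_quadraticField_iff {r : QBar} (hr : r ^ 2 = -3) (σ : GQ) :
    σ ∈ (quadraticField 3).fixingSubgroup ↔ σ r = r := by
  rw [IntermediateField.mem_fixingSubgroup_iff]
  constructor
  · exact fun h => h r (mem_quadraticField_of_sq_eq hr)
  · intro h x hx
    obtain ⟨a, b, rfl⟩ := exists_rat_of_mem_quadraticField hr hx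
    rw [map_add, map_mul, h, map_ratCast, map_ratCast]

theorem mem_quadraticField_of_fixed {x : QBar}
    (h : ∀ σ ∈ (quadraticField 3).fixingSubgroup, σ x = x) : x ∈ quadraticField 3 := by
  rw [← InfiniteGalois.fixedField_fixingSubgroup (quadraticField 3),
    IntermediateField.mem_fixedField_iff]
  exact h

theorem exists_rat_of_fixed {x : QBar} (h : ∀ σ : GQ, σ x = x) : ∃ q : ℚ, x = q := by
  have h1 := InfiniteGalois.fixedField_fixingSubgroup (⊥ : IntermediateField ℚ QBar)
  have : x ∈ (⊥ : IntermediateField ℚ QBar) := by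
    rw [← h1, IntermediateField.mem_fixedField_iff]
    exact fun σ _ => h σ
  obtain ⟨q, hq⟩ := IntermediateField.mem_bot.mp this
  exact ⟨q, by rw [← hq]; simp⟩

end ModThree

theorem ZMod.exists_sq_eq_neg_three (p : ℕ) [Fact p.Prime] (hp : p ≡ 1 [MOD 3]) :
    ∃ a : ZMod p, a ^ 2 = -3 := by
  have hp' := (Fact.out : p.Prime).two_le
  have hdvd : 3 ∣ Fintype.card (ZMod p)ˣ := by
    rw [ZMod.card_units]
    unfold Nat.ModEq at hp
    omega
  have : Fact (Nat.Prime 3) := ⟨Nat.prime_three⟩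
  obtain ⟨u, hu⟩ := exists_prime_orderOf_dvd_card 3 hdvd
  have hu3 : (u : ZMod p) ^ 3 = 1 := by
    rw [← Units.val_pow_eq_pow_val, ← hu, pow_orderOf_eq_one, Units.val_one]
  have hu1 : (u : ZMod p) - 1 ≠ 0 := by
    intro h0
    have : u = 1 := Units.ext (by rw [Units.val_one]; linear_combination h0)
    rw [this, orderOf_one] at hu
    omega
  have hω : (u : ZMod p) ^ 2 + u + 1 = 0 :=
    mul_left_cancel₀ hu1 (by linear_combination hu3)
  exact ⟨2 * u + 1, by linear_combination 4 * hω⟩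

/-- A primitive cube root of unity mod `p` gives `√-3` there, and Hensel lifts it: `2n` is a unit
because `p ∤ 6`. -/
theorem Padic.exists_sq_eq_neg_three (p : ℕ) [Fact p.Prime] (hp : p ≡ 1 [MOD 3]) :
    ∃ s : ℚ_[p], s ^ 2 = -3 := by
  have hp3 : p ≠ 3 := by rintro rfl; revert hp; decide
  have hp2 : p ≠ 2 := by rintro rfl; revert hp; decide
  obtain ⟨a, ha⟩ := ZMod.exists_sq_eq_neg_three p hp
  obtain ⟨n, rfl⟩ := ZMod.intCast_surjective a
  have hdvd : (p : ℤ) ∣ n ^ 2 + 3 := by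
    rw [← ZMod.intCast_zmod_eq_zero_iff_dvd]
    push_cast
    linear_combination ha
  have hP : Prime (p : ℤ) := Nat.prime_iff_prime_int.mp Fact.out
  have hndvd : ¬ (p : ℤ) ∣ 2 * n := by
    intro h
    rcases hP.dvd_or_dvd h with h2 | hn
    · have : p ∣ 2 := by exact_mod_cast h2
      exact hp2 ((Nat.prime_dvd_prime_iff_eq Fact.out Nat.prime_two).mp this)
    · have h3 : (p : ℤ) ∣ 3 := (Int.dvd_add_right (dvd_pow hn two_ne_zero)).mp hdvd
      have : p ∣ 3 := by exact_mod_cast h3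
      exact hp3 ((Nat.prime_dvd_prime_iff_eq Fact.out Nat.prime_three).mp this)
  have hlt : ‖((n ^ 2 + 3 : ℤ) : ℤ_[p])‖ < 1 := (PadicInt.norm_int_lt_one_iff_dvd _).mpr hdvd
  have heq : ‖((2 * n : ℤ) : ℤ_[p])‖ = 1 := by
    refine le_antisymm (PadicInt.norm_le_one _) ?_
    rw [← not_lt, PadicInt.norm_int_lt_one_iff_dvd]
    exact hndvd
  obtain ⟨z, hz, -⟩ := hensels_lemma (p := p) (F := (X ^ 2 + 3 : ℤ_[p][X])) (a := (n : ℤ_[p])) (by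
    have h1 : aeval (n : ℤ_[p]) (X ^ 2 + 3 : ℤ_[p][X]) = ((n ^ 2 + 3 : ℤ) : ℤ_[p]) := by simp
    have h2 : aeval (n : ℤ_[p]) (derivative (X ^ 2 + 3 : ℤ_[p][X])) = ((2 * n : ℤ) : ℤ_[p]) := by
      simp [one_add_one_eq_two]
    rw [h1, h2, heq]
    simpa using hlt)
  refine ⟨z, ?_⟩
  have : z ^ 2 = -3 := by
    simp at hz
    linear_combination hz
  rw [← PadicInt.coe_pow, this, PadicInt.coe_neg]
  rfl

/-- Under the hypotheses at `p`, no `3`-torsion point has its `x`-coordinate in `ℚ(√-3)`. -/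
theorem ModThree.eval_Ψ₃_ne_zero_of_mem_quadraticField (E : WeierstrassCurve ℚ) (p : ℕ)
    [Fact p.Prime] (hp : p ≡ 1 [MOD 3]) (hgood : HasGoodReductionAt E p)
    (ha : (3 : ℤ) ∣ traceOfFrobenius E p) {z : QBar} (hz : z ∈ quadraticField 3) :
    (E.baseChange QBar).Ψ₃.eval z ≠ 0 := by
  intro h0
  obtain ⟨r, hr⟩ := IsAlgClosed.exists_pow_nat_eq (-3 : QBar) (n := 2) (by norm_num)
  obtain ⟨a, b, rfl⟩ := exists_rat_of_mem_quadraticField hr hz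
  obtain ⟨s, hs⟩ := Padic.exists_sq_eq_neg_three p hp
  -- Any such embedding sends `r` to a square root of `-3`, and both of these lie in `ℚ_p`.
  let φ : QBar →ₐ[ℚ] AlgebraicClosure ℚ_[p] := IsAlgClosed.lift
  obtain ⟨s', hs', hφ⟩ : ∃ s' : ℚ_[p], s' ^ 2 = -3 ∧ φ r = algebraMap _ _ s' := by
    have h1 : (φ r) ^ 2 = (algebraMap ℚ_[p] (AlgebraicClosure ℚ_[p]) s) ^ 2 := by
      rw [← map_pow, ← map_pow, hr, hs, map_neg, map_neg, map_ofNat, map_ofNat]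
    rcases sq_eq_sq_iff_eq_or_eq_neg.mp h1 with h | h
    · exact ⟨s, hs, h⟩
    · exact ⟨-s, by rw [neg_sq, hs], by rw [h, map_neg]⟩
  apply eval_Ψ₃_padic_ne_zero E p hp hgood ha (a + b * s')
  have h1 : aeval ((a : QBar) + b * r) E.Ψ₃ = 0 := by
    rw [aeval_def, ← eval_map, ← WeierstrassCurve.map_Ψ₃]; exact h0
  have h2 : aeval (algebraMap ℚ_[p] (AlgebraicClosure ℚ_[p]) (a + b * s')) E.Ψ₃ = 0 := by
    have : algebraMap ℚ_[p] (AlgebraicClosure ℚ_[p]) (a + b * s') = φ ((a : QBar) + b * r) := by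
      rw [map_add, map_mul, map_add, map_mul, hφ]; simp
    rw [this, aeval_algHom_apply, h1, map_zero]
  rw [aeval_algebraMap_apply, map_eq_zero] at h2
  rw [aeval_def, ← eval_map, ← WeierstrassCurve.map_Ψ₃] at h2
  exact h2

end QuadraticField

/-! ### The groups `E[2]` and `E[3]` over `ℚ̄` -/

section Torsion

open ModThree WeierstrassCurve Polynomial

/-- The roots of `Ψ₂Sq` over `ℚ̄` are the abscissae of the points of order 2, which are rational;
the formulas are Vieta's. -/
theorem ModThree.exists_rational_roots_Ψ₂Sq (E : WeierstrassCurve ℚ) [E.IsElliptic]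
    (hE : HasFullRationalTwoTorsion E) :
    ∃ e₁ e₂ e₃ : ℚ, E.b₂ = -4 * (e₁ + e₂ + e₃) ∧ E.b₄ = 2 * (e₁ * e₂ + e₁ * e₃ + e₂ * e₃) ∧
      E.b₆ = -4 * (e₁ * e₂ * e₃) := by
  set W := E.baseChange QBar with hW
  have hΔ : W.Δ ≠ 0 := by
    rw [hW, WeierstrassCurve.baseChange, map_Δ, _root_.map_ne_zero]; exact E.isUnit_Δ.ne_zero
  have h2 : (2 : QBar) ≠ 0 := by norm_num
  have h4 : (4 : QBar) ≠ 0 := by norm_num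
  have hrat : ∀ x, W.Ψ₂Sq.eval x = 0 → ∃ q : ℚ, x = q := by
    intro x hx
    have heq : W.toAffine.Equation x ((0 - W.a₁ * x - W.a₃) / 2) := by
      rw [equation_iff_sq_eq_Ψ₂Sq h2, hx]
      field_simp
      ring
    have hns := (W.toAffine.equation_iff_nonsingular_of_Δ_ne_zero hΔ).mp heq
    obtain ⟨Q, hQ⟩ := hE (Affine.Point.some _ _ hns) (by
      rw [two_nsmul]
      apply Affine.Point.add_self_of_Y_eq
      rw [Affine.negY]
      field_simp
      ring)
    match Q with
    | 0 =>
      rw [map_zero] at hQ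
      exact absurd hQ.symm (Affine.Point.some_ne_zero hns)
    | .some x' y' h' =>
      have h := (Affine.Point.map_some (W' := E) (Algebra.ofId ℚ QBar) h').symm.trans hQ
      injection h with hx' _
      exact ⟨x', by rw [← hx']; simp⟩
  have hdeg := W.natDegree_Ψ₂Sq h4
  have hlead := W.leadingCoeff_Ψ₂Sq h4
  have hsplit := IsAlgClosed.splits W.Ψ₂Sq
  have hcard := hsplit.natDegree_eq_card_roots
  have hprod := hsplit.eq_prod_roots
  rw [hdeg] at hcard
  obtain ⟨x₁, x₂, x₃, hroots⟩ := Multiset.card_eq_three.mp hcard.symm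
  obtain ⟨e₁, rfl⟩ := hrat x₁ (mem_roots'.mp (hroots ▸ by simp : x₁ ∈ W.Ψ₂Sq.roots)).2
  obtain ⟨e₂, rfl⟩ := hrat x₂ (mem_roots'.mp (hroots ▸ by simp : x₂ ∈ W.Ψ₂Sq.roots)).2
  obtain ⟨e₃, rfl⟩ := hrat x₃ (mem_roots'.mp (hroots ▸ by simp : x₃ ∈ W.Ψ₂Sq.roots)).2
  have hev : ∀ x : ℚ, 4 * x ^ 3 + E.b₂ * x ^ 2 + 2 * E.b₄ * x + E.b₆ =
      4 * ((x - e₁) * (x - e₂) * (x - e₃)) := by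
    intro x
    have h := congrArg (eval (x : QBar)) hprod
    rw [hroots, hlead, eval_Ψ₂Sq] at h
    simp [hW, WeierstrassCurve.baseChange] at h
    have h' : (4 * (x : QBar) ^ 3 + E.b₂ * (x : QBar) ^ 2 + 2 * E.b₄ * (x : QBar) + E.b₆ : QBar) =
      4 * (((x : QBar) - e₁) * ((x : QBar) - e₂) * ((x : QBar) - e₃)) := by
      linear_combination h
    exact_mod_cast h'
  obtain ⟨-, k2, k4, k6⟩ := cubic_coeffs_eq_zero (x₁ := (0 : ℚ)) (x₂ := 1) (x₃ := 2) (x₄ := 3)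
    (a := 0) (b := E.b₂ + 4 * (e₁ + e₂ + e₃))
    (c := 2 * E.b₄ - 4 * (e₁ * e₂ + e₁ * e₃ + e₂ * e₃)) (d := E.b₆ + 4 * (e₁ * e₂ * e₃))
    (by norm_num) (by norm_num) (by norm_num) (by norm_num) (by norm_num) (by norm_num)
    (by linear_combination hev 0) (by linear_combination hev 1) (by linear_combination hev 2)
    (by linear_combination hev 3)
  exact ⟨e₁, e₂, e₃, by linear_combination k2, by linear_combination k4 / 2,
    by linear_combination k6⟩

variable (E : WeierstrassCurve ℚ)

theorem ModThree.three_nsmul_torsion (P : Torsion E 3) : 3 • P.1 = 0 :=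
  AddSubgroup.torsionBy.nsmul_iff.mp P.2

/-- The four `x`-coordinates of the nonzero points of the plane spanned by `e` and `f` are the
roots of the `3`-division polynomial. -/
theorem ModThree.hasΨ₃Roots_xCoord {e f : Torsion E 3} (he : e ≠ 0) (hf : f ≠ 0) (h1 : f ≠ e)
    (h2 : f ≠ -e) :
    (E.baseChange QBar).HasΨ₃Roots e.1.xCoord (e + f).1.xCoord f.1.xCoord (e - f).1.xCoord ∧
    e.1.xCoord ≠ (e + f).1.xCoord ∧ e.1.xCoord ≠ f.1.xCoord ∧ e.1.xCoord ≠ (e - f).1.xCoord ∧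
    (e + f).1.xCoord ≠ f.1.xCoord ∧ (e + f).1.xCoord ≠ (e - f).1.xCoord ∧
    f.1.xCoord ≠ (e - f).1.xCoord := by
  obtain ⟨k1, k2, k3, k4, k5, k6⟩ := Affine.Point.xCoord_ne_of_three_torsion
    (three_nsmul_torsion E e) (three_nsmul_torsion E f) (fun h => he (Subtype.ext h))
    (fun h => hf (Subtype.ext h)) (fun h => h1 (Subtype.ext h)) (fun h => h2 (Subtype.ext h))
  have hs : e + f ≠ 0 := fun h => h2 (eq_neg_of_add_eq_zero_right h)
  have hd : e - f ≠ 0 := fun h => h1 (sub_eq_zero.mp h).symm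
  have hroot : ∀ P : Torsion E 3, P ≠ 0 → (E.baseChange QBar).Ψ₃.eval P.1.xCoord = 0 :=
    fun P hP => Affine.Point.Ψ₃_eval_xCoord (fun h => hP (Subtype.ext h)) (three_nsmul_torsion E P)
  exact ⟨vieta_Ψ₃ _ k2 k1 k3 k4.symm k6 k5 (hroot e he) (hroot _ hs) (hroot f hf) (hroot _ hd),
    k2, k1, k3, k4.symm, k6, k5⟩

theorem ModThree.xCoord_eq_iff {P Q : Torsion E 3} (hP : P ≠ 0) (hQ : Q ≠ 0) :
    P.1.xCoord = Q.1.xCoord ↔ P = Q ∨ P = -Q := by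
  rw [Affine.Point.xCoord_eq_iff (fun h => hP (Subtype.ext h)) (fun h => hQ (Subtype.ext h)),
    Subtype.ext_iff, Subtype.ext_iff]
  rfl

theorem ModThree.exists_torsion_xCoord_eq (hΔ : (E.baseChange QBar).Δ ≠ 0) {x : QBar}
    (hx : (E.baseChange QBar).Ψ₃.eval x = 0) : ∃ P : Torsion E 3, P ≠ 0 ∧ P.1.xCoord = x := by
  have h2 : (2 : QBar) ≠ 0 := by norm_num
  set W := E.baseChange QBar with hW
  obtain ⟨z, hz⟩ := IsAlgClosed.exists_pow_nat_eq (W.Ψ₂Sq.eval x) (n := 2) (by norm_num)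
  have heq : W.toAffine.Equation x ((z - W.a₁ * x - W.a₃) / 2) := by
    rw [equation_iff_sq_eq_Ψ₂Sq h2, ← hz]
    congr 1
    field_simp
    ring
  have hns := (W.toAffine.equation_iff_nonsingular_of_Δ_ne_zero hΔ).mp heq
  refine ⟨⟨Affine.Point.some _ _ hns, AddSubgroup.torsionBy.nsmul_iff.mpr
    ((Affine.Point.three_smul_some_eq_zero_iff hns).mpr hx)⟩, ?_, rfl⟩
  exact fun h => Affine.Point.some_ne_zero hns (congrArg Subtype.val h)

/-- Two distinct roots of `Ψ₃` give independent `e, f`. The abscissae of `e`, `e + f`, `f`, `e - f`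
exhaust the four roots, so up to sign there are no other nonzero points. -/
theorem ModThree.finrank_torsion_three (hΔ : (E.baseChange QBar).Δ ≠ 0) :
    Module.finrank (ZMod 3) (Torsion E 3) = 2 := by
  obtain ⟨x, y, hxy, hx, hy⟩ := exists_ne_roots_Ψ₃ _ hΔ
  obtain ⟨e, he, rfl⟩ := exists_torsion_xCoord_eq E hΔ hx
  obtain ⟨f, hf, rfl⟩ := exists_torsion_xCoord_eq E hΔ hy
  have hne := (xCoord_eq_iff E he hf).not.mp hxy
  push Not at hne
  have h1 : f ≠ e := hne.1.symm
  have h2 : f ≠ -e := fun h => hne.2 (by rw [h, neg_neg])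
  obtain ⟨hroots, -⟩ := hasΨ₃Roots_xCoord E he hf h1 h2
  have hs : e + f ≠ 0 := fun h => h2 (eq_neg_of_add_eq_zero_right h)
  have hd : e - f ≠ 0 := fun h => h1 (sub_eq_zero.mp h).symm
  let φ : (ZMod 3 × ZMod 3) →ₗ[ZMod 3] Torsion E 3 :=
    (LinearMap.toSpanSingleton (ZMod 3) _ e).coprod (LinearMap.toSpanSingleton (ZMod 3) _ f)
  have hφ : ∀ a b, φ (a, b) = a • e + b • f := fun a b => by simp [φ]
  have hinj : Function.Injective φ := by
    rw [← LinearMap.ker_eq_bot, LinearMap.ker_eq_bot']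
    rintro ⟨a, b⟩ hab
    rw [hφ] at hab
    rcases ZMod.three_cases a with rfl | rfl | rfl <;>
      rcases ZMod.three_cases b with rfl | rfl | rfl <;> simp at hab
    · rfl
    · exact absurd hab hf
    · exact absurd hab hf
    · exact absurd hab he
    · exact absurd hab hs
    · exact absurd (by rwa [sub_eq_add_neg]) hd
    · exact absurd hab he
    · exact absurd (neg_add_eq_zero.mp hab).symm h1
    · exact absurd (by rw [← neg_eq_zero, ← hab]; abel) hs
  have hsurj : Function.Surjective φ := by
    intro g
    by_cases hg : g = 0
    · exact ⟨0, by rw [hg, map_zero]⟩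
    have hgx : (E.baseChange QBar).Ψ₃.eval g.1.xCoord = 0 :=
      Affine.Point.Ψ₃_eval_xCoord (fun h => hg (Subtype.ext h)) (three_nsmul_torsion E g)
    rw [eval_Ψ₃_eq _ hroots] at hgx
    simp only [mul_eq_zero, OfNat.ofNat_ne_zero, false_or, sub_eq_zero] at hgx
    rcases hgx with ((h | h) | h) | h
    · rcases (xCoord_eq_iff E hg he).mp h with rfl | rfl
      · exact ⟨(1, 0), by rw [hφ]; simp⟩
      · exact ⟨(-1, 0), by rw [hφ]; simp⟩
    · rcases (xCoord_eq_iff E hg hs).mp h with rfl | rfl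
      · exact ⟨(1, 1), by rw [hφ]; simp⟩
      · exact ⟨(-1, -1), by rw [hφ]; simp; abel⟩
    · rcases (xCoord_eq_iff E hg hf).mp h with rfl | rfl
      · exact ⟨(0, 1), by rw [hφ]; simp⟩
      · exact ⟨(0, -1), by rw [hφ]; simp⟩
    · rcases (xCoord_eq_iff E hg hd).mp h with rfl | rfl
      · exact ⟨(1, -1), by rw [hφ]; simp; abel⟩
      · exact ⟨(-1, 1), by rw [hφ]; simp; abel⟩
  rw [← (LinearEquiv.ofBijective φ ⟨hinj, hsurj⟩).finrank_eq]
  simp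

theorem ModThree.xCoord_torsionRep (σ : GQ) {P : Torsion E 3} (hP : P ≠ 0) :
    (torsionRep E 3 σ P).1.xCoord = σ P.1.xCoord := by
  obtain ⟨P, hP3⟩ := P
  match P with
  | 0 => exact absurd rfl hP
  | .some x y h => rfl

end Torsion

/-! ### The Galois action on the roots of `Ψ₃` and the conclusion -/

section Main

open ModThree WeierstrassCurve Polynomial

/-- If the `3`-division polynomial of an elliptic curve over `ℚ` is a product of two rational
quadratics and the corresponding root of the resolvent cubic is a cube root of the discriminant,
then the curve does not have full rational `2`-torsion. -/
theorem WeierstrassCurve.not_factors_of_rational_two_torsion (E : WeierstrassCurve ℚ) (hΔ : E.Δ ≠ 0)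
    {e₁ e₂ e₃ s t m n : ℚ} (h2 : E.b₂ = -4 * (e₁ + e₂ + e₃))
    (h4 : E.b₄ = 2 * (e₁ * e₂ + e₁ * e₃ + e₂ * e₃)) (h6 : E.b₆ = -4 * (e₁ * e₂ * e₃))
    (k2 : E.b₂ = -3 * (s + t)) (k4 : E.b₄ = m + n + s * t) (k6 : E.b₆ = -(s * n + t * m))
    (k8 : E.b₈ = 3 * (m * n)) (hres : (E.b₄ - 3 * (m + n)) ^ 3 = E.Δ) : False := by
  have h8 : E.b₈ = 4 * (e₁ + e₂ + e₃) * (e₁ * e₂ * e₃) - (e₁ * e₂ + e₁ * e₃ + e₂ * e₃) ^ 2 := by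
    have := E.b_relation
    rw [h2, h4, h6] at this
    linear_combination this / 4
  have hdisc : E.Δ = 16 * ((e₁ - e₂) * (e₂ - e₃) * (e₁ - e₃)) ^ 2 := by
    rw [Δ, h2, h4, h6, h8]; ring
  set T := E.b₄ - 3 * (m + n) with hT
  have hT0 : T ≠ 0 := by
    intro h0; rw [h0] at hres; exact hΔ (by rw [← hres]; norm_num)
  have hD0 : (e₁ - e₂) * (e₂ - e₃) * (e₁ - e₃) ≠ 0 := by
    intro h0; rw [h0] at hdisc; exact hΔ (by rw [hdisc]; norm_num)
  -- With `P` the product of the differences, `T³ = Δ = 16P²`, so `(4P/T)³ = 4P`.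
  have hcube : 4 * (e₁ - e₂) * (e₂ - e₃) * ((e₁ - e₂) + (e₂ - e₃)) =
      (4 * ((e₁ - e₂) * (e₂ - e₃) * (e₁ - e₃)) / T) ^ 3 := by
    rw [div_pow, hres, hdisc]
    field_simp
    ring
  -- The case of abscissae `a - D`, `a`, `a + D`. The three outcomes of Euler's theorem say which
  -- abscissa is the middle term `a`.
  have key : ∀ a D : ℚ, D ≠ 0 → e₁ + e₂ + e₃ = 3 * a →
      e₁ * e₂ + e₁ * e₃ + e₂ * e₃ = 3 * a ^ 2 - D ^ 2 → e₁ * e₂ * e₃ = a * (a ^ 2 - D ^ 2) →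
      False := by
    intro a D hD j1 j2 j3
    rw [j1, j2, j3] at h8
    rw [j1] at h2
    rw [j2] at h4
    rw [j3] at h6
    exact not_product_of_quadratics (a := a) (D := D) (s := s) (t := t) (m := m) (n := n) hD
      (by linear_combination (k2 - h2) / 3) (by linear_combination h4 - k4)
      (by linear_combination k6 - h6) (by linear_combination h8 - k8)
  have hA : e₁ - e₂ ≠ 0 := fun h0 => hD0 (by rw [h0]; ring)
  have hB : e₂ - e₃ ≠ 0 := fun h0 => hD0 (by rw [h0]; ring)
  have hAB : (e₁ - e₂) + (e₂ - e₃) ≠ 0 := fun h0 => hD0 (by linear_combination (e₁ - e₂) * (e₂ - e₃) * h0)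
  rcases Rat.of_four_mul_mul_add_eq_cube hA hB hAB hcube with h | h | h
  · obtain rfl : e₁ = 2 * e₂ - e₃ := by linarith
    exact key e₂ (e₂ - e₃) hB (by ring) (by ring) (by ring)
  · obtain rfl : e₁ = 2 * e₃ - e₂ := by linarith
    exact key e₃ (e₂ - e₃) hB (by ring) (by ring) (by ring)
  · obtain rfl : e₃ = 2 * e₁ - e₂ := by linarith
    exact key e₁ (e₁ - e₂) hA (by ring) (by ring) (by ring)

namespace ModThree

theorem xCoord_neg (E : WeierstrassCurve ℚ) (P : Torsion E 3) : (-P).1.xCoord = P.1.xCoord :=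
  congrFun (Affine.Point.xRep_neg P.1) 0

theorem map_xCoord_of_torsionRep_eq {E : WeierstrassCurve ℚ} {σ : GQ} {P Q : Torsion E 3}
    (hP : P ≠ 0) (h : torsionRep E 3 σ P = Q ∨ torsionRep E 3 σ P = -Q) :
    σ P.1.xCoord = Q.1.xCoord := by
  rw [← xCoord_torsionRep E σ hP]
  rcases h with h | h
  · rw [h]
  · rw [h, xCoord_neg]

/-- An automorphism acting on `E[3]` as a multiplication by an element of `𝔽₉` fixes the roots of
the `3`-division polynomial, or exchanges them in pairs, or permutes them cyclically. -/
theorem map_xCoord_of_torsionRep {E : WeierstrassCurve ℚ} {σ : GQ} {e f : Torsion E 3}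
    (he : e ≠ 0) (hf : f ≠ 0) (h1 : f ≠ e) (h2 : f ≠ -e) {a c : ZMod 3}
    (hσe : torsionRep E 3 σ e = a • e + c • f) (hσf : torsionRep E 3 σ f = -c • e + a • f) :
    let x₁ := e.1.xCoord
    let x₂ := (e + f).1.xCoord
    let x₃ := f.1.xCoord
    let x₄ := (e - f).1.xCoord
    (σ x₁ = x₁ ∧ σ x₂ = x₂ ∧ σ x₃ = x₃ ∧ σ x₄ = x₄) ∨
    (σ x₁ = x₃ ∧ σ x₂ = x₄ ∧ σ x₃ = x₁ ∧ σ x₄ = x₂) ∨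
    (σ x₁ = x₂ ∧ σ x₂ = x₃ ∧ σ x₃ = x₄ ∧ σ x₄ = x₁) ∨
    (σ x₁ = x₄ ∧ σ x₂ = x₁ ∧ σ x₃ = x₂ ∧ σ x₄ = x₃) := by
  intro x₁ x₂ x₃ x₄
  have hs : e + f ≠ 0 := fun h => h2 (eq_neg_of_add_eq_zero_right h)
  have hd : e - f ≠ 0 := fun h => h1 (sub_eq_zero.mp h).symm
  have h3e : (3 : ℤ) • e = 0 := by
    have : (3 : ℤ) • e = (3 : ℕ) • e := by norm_cast
    rw [this]
    exact Subtype.ext (three_nsmul_torsion E e)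
  have h3f : (3 : ℤ) • f = 0 := by
    have : (3 : ℤ) • f = (3 : ℕ) • f := by norm_cast
    rw [this]
    exact Subtype.ext (three_nsmul_torsion E f)
  have hσs : torsionRep E 3 σ (e + f) = (a • e + c • f) + (-c • e + a • f) := by
    rw [map_add, hσe, hσf]
  have hσd : torsionRep E 3 σ (e - f) = (a • e + c • f) - (-c • e + a • f) := by
    rw [map_sub, hσe, hσf]
  have key := fun (P Q : Torsion E 3) (hP : P ≠ 0) => map_xCoord_of_torsionRep_eq (σ := σ) (Q := Q) hP
  -- Up to sign, `1 + J` maps `e ↦ e + f ↦ f ↦ e - f ↦ e`, which explains the order of the `xᵢ`; its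
  -- square `J` up to sign is the case `a = 0`.
  rcases ZMod.three_cases a with rfl | rfl | rfl <;>
    rcases ZMod.three_cases c with rfl | rfl | rfl <;>
    simp only [zero_smul, one_smul, neg_smul, neg_zero, zero_add, add_zero, neg_neg,
      sub_zero, sub_neg_eq_add] at hσe hσf hσs hσd
  · exfalso
    apply he
    have : torsionRep E 3 σ⁻¹ (torsionRep E 3 σ e) = e := by
      rw [← Module.End.mul_apply, ← map_mul]; simp
    rw [← this, hσe, map_zero]
  · right; left
    refine ⟨key _ _ he (Or.inl hσe), key _ _ hs (Or.inr ?_), key _ _ hf (Or.inr hσf),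
      key _ _ hd (Or.inl ?_)⟩
    · rw [hσs]; abel
    · rw [hσd]; abel
  · right; left
    refine ⟨key _ _ he (Or.inr hσe), key _ _ hs (Or.inl ?_), key _ _ hf (Or.inl hσf),
      key _ _ hd (Or.inr ?_)⟩
    · rw [hσs]; abel
    · rw [hσd]; abel
  · left
    exact ⟨key _ _ he (Or.inl hσe), key _ _ hs (Or.inl hσs), key _ _ hf (Or.inl hσf),
      key _ _ hd (Or.inl hσd)⟩
  · right; right; left
    refine ⟨key _ _ he (Or.inl hσe), key _ _ hs (Or.inr ?_), key _ _ hf (Or.inr ?_),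
      key _ _ hd (Or.inr ?_)⟩
    · rw [hσs]; linear_combination (norm := module) h3f
    · rw [hσf]; abel
    · rw [hσd]; linear_combination (norm := module) h3e
  · right; right; right
    refine ⟨key _ _ he (Or.inl ?_), key _ _ hs (Or.inr ?_), key _ _ hf (Or.inl ?_),
      key _ _ hd (Or.inl ?_)⟩
    · rw [hσe]; abel
    · rw [hσs]; linear_combination (norm := module) h3e
    · rw [hσf]
    · rw [hσd]; linear_combination (norm := module) (-1 : ℤ) • h3f
  · left
    refine ⟨key _ _ he (Or.inr hσe), key _ _ hs (Or.inr ?_), key _ _ hf (Or.inr hσf),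
      key _ _ hd (Or.inr ?_)⟩
    · rw [hσs]; abel
    · rw [hσd]; abel
  · right; right; right
    refine ⟨key _ _ he (Or.inr ?_), key _ _ hs (Or.inl ?_), key _ _ hf (Or.inr ?_),
      key _ _ hd (Or.inr ?_)⟩
    · rw [hσe]; abel
    · rw [hσs]; linear_combination (norm := module) (-1 : ℤ) • h3e
    · rw [hσf]; abel
    · rw [hσd]; linear_combination (norm := module) h3f
  · right; right; left
    refine ⟨key _ _ he (Or.inr ?_), key _ _ hs (Or.inl ?_), key _ _ hf (Or.inl ?_),
      key _ _ hd (Or.inl ?_)⟩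
    · rw [hσe]; abel
    · rw [hσs]; linear_combination (norm := module) (-1 : ℤ) • h3f
    · rw [hσf]; abel
    · rw [hσd]; linear_combination (norm := module) (-1 : ℤ) • h3e

/-- Over `ℚ(√-3)` the `3`-division polynomial has square discriminant, so that the Galois group
does not permute its roots cyclically. -/
theorem not_cyclic_of_mem_fixingSubgroup {E : WeierstrassCurve ℚ} (hΔ : E.Δ ≠ 0) {x₁ x₂ x₃ x₄ : QBar}
    (hroots : (E.baseChange QBar).HasΨ₃Roots x₁ x₂ x₃ x₄) {σ : GQ}
    (hσ : σ ∈ (quadraticField 3).fixingSubgroup) :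
    ¬ (σ x₁ = x₂ ∧ σ x₂ = x₃ ∧ σ x₃ = x₄ ∧ σ x₄ = x₁) ∧
    ¬ (σ x₁ = x₄ ∧ σ x₂ = x₁ ∧ σ x₃ = x₂ ∧ σ x₄ = x₃) := by
  have hsq := sq_prod_sub_roots_Ψ₃ _ hroots
  set δ := (x₁ - x₂) * (x₁ - x₃) * (x₁ - x₄) * (x₂ - x₃) * (x₂ - x₄) * (x₃ - x₄) with hδ
  have hW : (E.baseChange QBar).Δ = (E.Δ : QBar) := by
    rw [WeierstrassCurve.baseChange, map_Δ]; simp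
  rw [hW] at hsq
  have hΔ' : (E.Δ : QBar) ≠ 0 := by exact_mod_cast hΔ
  -- So `δ` lies in `ℚ(√-3)` and is fixed by `σ`, whereas a 4-cycle is odd and negates it.
  have hr : (9 * δ / E.Δ) ^ 2 = -3 := by
    rw [div_pow, hsq]; field_simp
  have hfix := (mem_fixingSubgroup_quadraticField_iff hr σ).mp hσ
  have hδ0 : δ ≠ 0 := by
    intro h0
    rw [h0] at hr
    norm_num at hr
  have hfixδ : σ δ = δ := by
    rw [map_div₀, map_mul, map_ratCast, map_ofNat, div_left_inj' hΔ'] at hfix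
    exact mul_left_cancel₀ (by norm_num) hfix
  have hcontra : σ δ ≠ -δ := by
    rw [hfixδ]
    intro h
    exact hδ0 (self_eq_neg.mp h)
  constructor <;> rintro ⟨k1, k2, k3, k4⟩ <;> apply hcontra <;> rw [hδ] <;>
    simp only [map_mul, map_sub, k1, k2, k3, k4] <;> ring

/-- If `τ` exchanges `x₁` with `x₃` and `x₂` with `x₄`, then a permutation `g` of the four elements
commuting with `τ` preserves or exchanges the pairs `{x₁, x₃}` and `{x₂, x₄}`. -/
theorem preserves_or_swaps_pairs {x₁ x₂ x₃ x₄ : QBar} (h12 : x₁ ≠ x₂) (h14 : x₁ ≠ x₄) {τ g : GQ}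
    (hτ : τ x₁ = x₃ ∧ τ x₂ = x₄ ∧ τ x₃ = x₁ ∧ τ x₄ = x₂)
    (hg : ∀ x, (x = x₁ ∨ x = x₂ ∨ x = x₃ ∨ x = x₄) →
      (g x = x₁ ∨ g x = x₂ ∨ g x = x₃ ∨ g x = x₄))
    (hg3 : τ (g x₁) = g x₃) (hg4 : τ (g x₂) = g x₄) :
    (g (x₁ + x₃) = x₁ + x₃ ∧ g (x₁ * x₃) = x₁ * x₃ ∧ g (x₂ + x₄) = x₂ + x₄ ∧
      g (x₂ * x₄) = x₂ * x₄) ∨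
    (g (x₁ + x₃) = x₂ + x₄ ∧ g (x₁ * x₃) = x₂ * x₄ ∧ g (x₂ + x₄) = x₁ + x₃ ∧
      g (x₂ * x₄) = x₁ * x₃) := by
  obtain ⟨t1, t2, t3, t4⟩ := hτ
  have i12 : g x₁ ≠ g x₂ := g.injective.ne h12
  have i14 : g x₁ ≠ g x₄ := g.injective.ne h14
  simp only [map_add, map_mul]
  -- Commutation with `τ` makes `g x₁` and `g x₂` determine `g x₃` and `g x₄`.
  rcases hg x₁ (by simp) with k1 | k1 | k1 | k1 <;>
    rcases hg x₂ (by simp) with k2 | k2 | k2 | k2 <;>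
    rw [k1] at hg3 i12 i14 <;> rw [k2] at hg4 i12 <;>
    simp only [t1, t2, t3, t4] at hg3 hg4 <;>
    rw [← hg4] at i14 <;>
    first
    | exact absurd rfl i12
    | exact absurd rfl i14
    | (left
       rw [k1, k2, ← hg3, ← hg4]
       refine ⟨?_, ?_, ?_, ?_⟩ <;> ring1)
    | (right
       rw [k1, k2, ← hg3, ← hg4]
       refine ⟨?_, ?_, ?_, ?_⟩ <;> ring1)

/-- Two quadratic factors of the `3`-division polynomial over `ℚ(√-3)` are not conjugate if the
curve has a rational `2`-torsion point. -/
theorem not_conjugate_factors {E : WeierstrassCurve ℚ} {e₁ e₂ e₃ : ℚ}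
    (h2 : E.b₂ = -4 * (e₁ + e₂ + e₃)) (h4 : E.b₄ = 2 * (e₁ * e₂ + e₁ * e₃ + e₂ * e₃))
    (h6 : E.b₆ = -4 * (e₁ * e₂ * e₃)) (h12 : e₁ ≠ e₂) (h13 : e₁ ≠ e₃) {r n : QBar}
    (hr : r ^ 2 = -3) (hn : n ∈ quadraticField 3) {g : GQ} (hg : g r ≠ r)
    (hprod : (E.baseChange QBar).Ψ₃.eval (e₁ : QBar) = 3 * (n * g n)) : False := by
  obtain ⟨a, b, rfl⟩ := exists_rat_of_mem_quadraticField hr hn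
  have hgr : g r = -r := by
    have h1 : (g r) ^ 2 = r ^ 2 := by rw [← map_pow, hr, map_neg, map_ofNat]
    exact (sq_eq_sq_iff_eq_or_eq_neg.mp h1).resolve_left hg
  have h8 : E.b₈ = 4 * (e₁ + e₂ + e₃) * (e₁ * e₂ * e₃) - (e₁ * e₂ + e₁ * e₃ + e₂ * e₃) ^ 2 := by
    have := E.b_relation
    rw [h2, h4, h6] at this
    linear_combination this / 4
  have hev : E.Ψ₃.eval e₁ = -((e₁ - e₂) * (e₁ - e₃)) ^ 2 := by
    rw [eval_Ψ₃, h2, h4, h6, h8]; ring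
  have hev' : (E.baseChange QBar).Ψ₃.eval (e₁ : QBar) = ((E.Ψ₃.eval e₁ : ℚ) : QBar) := by
    have h : (e₁ : QBar) = algebraMap ℚ QBar e₁ := by simp
    rw [WeierstrassCurve.baseChange, map_Ψ₃, h, eval_map, eval₂_at_apply]
    simp
  rw [hev', hev, map_add, map_mul, map_ratCast, map_ratCast, hgr] at hprod
  -- The norm of `n = a + b√-3` is `a² + 3b² ≥ 0`, while the left side is negative.
  have hq : -((e₁ - e₂) * (e₁ - e₃)) ^ 2 = 3 * (a ^ 2 + 3 * b ^ 2) := by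
    have : ((-((e₁ - e₂) * (e₁ - e₃)) ^ 2 : ℚ) : QBar) =
        ((3 * (a ^ 2 + 3 * b ^ 2) : ℚ) : QBar) := by
      rw [hprod]; push_cast; linear_combination (-3 * (b : QBar) ^ 2) * hr
    exact_mod_cast this
  have hpos : 0 < ((e₁ - e₂) * (e₁ - e₃)) ^ 2 := by
    have := mul_ne_zero (sub_ne_zero.mpr h12) (sub_ne_zero.mpr h13)
    positivity
  nlinarith [sq_nonneg a, sq_nonneg b]

end ModThree

theorem proposition3p5 (E : WeierstrassCurve ℚ) [E.IsElliptic]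
    (hE : ModThree.HasFullRationalTwoTorsion E)
    (p : ℕ) [Fact p.Prime] (hp : p ≡ 1 [MOD 3])
    (hgood : ModThree.HasGoodReductionAt E p)
    (ha : (3 : ℤ) ∣ ModThree.traceOfFrobenius E p) :
    ModThree.IsStronglyIrreducible 3 (ModThree.torsionRep E 3) := by
  have hΔ : E.Δ ≠ 0 := E.isUnit_Δ.ne_zero
  have hΔW : (E.baseChange QBar).Δ ≠ 0 := by
    rw [WeierstrassCurve.baseChange, map_Δ, _root_.map_ne_zero]; exact hΔ
  obtain ⟨r, hr⟩ := IsAlgClosed.exists_pow_nat_eq (-3 : QBar) (n := 2) (by norm_num)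
  have hnoroot : ∀ x : QBar, (E.baseChange QBar).Ψ₃.eval x = 0 →
      ¬ ∀ σ ∈ (quadraticField 3).fixingSubgroup, σ x = x := fun x hx hfix =>
    eval_Ψ₃_ne_zero_of_mem_quadraticField E p hp hgood ha (mem_quadraticField_of_fixed hfix) hx
  by_contra hirr
  rcases of_not_isAbsolutelyIrreducible (finrank_torsion_three E hΔW) _ hirr with
    ⟨v, hv, hline⟩ | ⟨e, f, he, hf, hef1, hef2, hact⟩
  · exact hnoroot v.1.xCoord
      (Affine.Point.Ψ₃_eval_xCoord (fun h => hv (Subtype.ext h)) (three_nsmul_torsion E v))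
      fun σ hσ => map_xCoord_of_torsionRep_eq hv (hline ⟨σ, hσ⟩)
  obtain ⟨hroots, h12, h13, h14, h23, h24, h34⟩ := hasΨ₃Roots_xCoord E he hf hef1 hef2
  have hmap : ∀ σ ∈ (quadraticField 3).fixingSubgroup, _ := fun σ hσ =>
    (hact ⟨σ, hσ⟩).elim fun a h => h.elim fun c h =>
      map_xCoord_of_torsionRep he hf hef1 hef2 h.1 h.2
  simp only at hmap
  generalize e.1.xCoord = x₁ at *
  generalize (e + f).1.xCoord = x₂ at *
  generalize f.1.xCoord = x₃ at *
  generalize (e - f).1.xCoord = x₄ at *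
  have hH : ∀ σ ∈ (quadraticField 3).fixingSubgroup,
      (σ x₁ = x₁ ∧ σ x₂ = x₂ ∧ σ x₃ = x₃ ∧ σ x₄ = x₄) ∨
      (σ x₁ = x₃ ∧ σ x₂ = x₄ ∧ σ x₃ = x₁ ∧ σ x₄ = x₂) := by
    intro σ hσ
    obtain ⟨n1, n2⟩ := not_cyclic_of_mem_fixingSubgroup hΔ hroots hσ
    rcases hmap σ hσ with h | h | h | h
    · exact Or.inl h
    · exact Or.inr h
    · exact absurd h n1
    · exact absurd h n2
  have hroot_iff : ∀ x, (E.baseChange QBar).Ψ₃.eval x = 0 ↔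
      (x = x₁ ∨ x = x₂ ∨ x = x₃ ∨ x = x₄) := by
    intro x
    rw [eval_Ψ₃_eq _ hroots]
    simp only [mul_eq_zero, OfNat.ofNat_ne_zero, false_or, sub_eq_zero, or_assoc]
  obtain ⟨τ, hτ, hτx⟩ : ∃ τ ∈ (quadraticField 3).fixingSubgroup,
      (τ x₁ = x₃ ∧ τ x₂ = x₄ ∧ τ x₃ = x₁ ∧ τ x₄ = x₂) := by
    by_contra! hno
    refine hnoroot x₁ ((hroot_iff x₁).mpr (Or.inl rfl)) fun σ hσ => ?_
    rcases hH σ hσ with h | h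
    · exact h.1
    · exact absurd h.2.2.2 (hno σ hσ h.1 h.2.1 h.2.2.1)
  have hroot_map : ∀ (g : GQ) x, (x = x₁ ∨ x = x₂ ∨ x = x₃ ∨ x = x₄) →
      (g x = x₁ ∨ g x = x₂ ∨ g x = x₃ ∨ g x = x₄) := by
    intro g x hx
    rw [← hroot_iff] at hx ⊢
    have h1 : aeval x E.Ψ₃ = 0 := by
      rw [aeval_def, ← eval_map, ← map_Ψ₃]; exact hx
    have h2 : aeval (g x) E.Ψ₃ = 0 := by
      rw [← AlgEquiv.coe_toAlgHom, aeval_algHom_apply, h1, map_zero]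
    rw [aeval_def, ← eval_map, ← map_Ψ₃] at h2
    exact h2
  have hgr : ∀ g : GQ, g r = r ∨ g r = -r := by
    intro g
    have h1 : (g r) ^ 2 = r ^ 2 := by rw [← map_pow, hr, map_neg, map_ofNat]
    exact sq_eq_sq_iff_eq_or_eq_neg.mp h1
  -- The conjugate `g⁻¹τg` lies in `G_K` by normality. It is not trivial on the roots, since `τ`
  -- would then fix the root `g x₁`; hence it acts as `τ` does.
  have hpairs : ∀ g : GQ, _ := fun g => by
    have hconj : ∀ x, (g⁻¹ * τ * g) x = g⁻¹ (τ (g x)) := fun x => rfl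
    have hmem : g⁻¹ * τ * g ∈ (quadraticField 3).fixingSubgroup := by
      rw [mem_fixingSubgroup_quadraticField_iff hr] at hτ ⊢
      have hinv : g⁻¹ (g r) = r := AlgEquiv.symm_apply_apply g r
      have hτg : τ (g r) = g r := by
        rcases hgr g with h | h
        · rw [h, hτ]
        · rw [h, map_neg, hτ]
      rw [hconj, hτg, hinv]
    have happ : ∀ x y, (g⁻¹ * τ * g) x = y → τ (g x) = g y := by
      intro x y hxy
      rw [← hxy, hconj]
      exact (AlgEquiv.apply_symm_apply g _).symm
    have hswap : τ (g x₁) = g x₃ ∧ τ (g x₂) = g x₄ := by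
      rcases hH _ hmem with h | h
      · exfalso
        have h1 := happ _ _ h.1
        obtain ⟨t1, t2, t3, t4⟩ := hτx
        rcases hroot_map g x₁ (Or.inl rfl) with k | k | k | k <;> rw [k] at h1
        · exact h13 (by rw [← h1, t1])
        · exact h24 (by rw [← h1, t2])
        · exact h13 (by rw [← h1, t3])
        · exact h24 (by rw [← h1, t4])
      · exact ⟨happ _ _ h.1, happ _ _ h.2.1⟩
    exact preserves_or_swaps_pairs h12 h14 hτx (hroot_map g) hswap.1 hswap.2
  have hpairsH : ∀ σ ∈ (quadraticField 3).fixingSubgroup, σ (x₁ + x₃) = x₁ + x₃ ∧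
      σ (x₁ * x₃) = x₁ * x₃ := by
    intro σ hσ
    rcases hH σ hσ with h | h
    · simp only [map_add, map_mul, h.1, h.2.2.1, and_self]
    · simp only [map_add, map_mul, h.1, h.2.2.1]
      exact ⟨add_comm _ _, mul_comm _ _⟩
  obtain ⟨e₁, e₂, e₃, j2, j4, j6⟩ := exists_rational_roots_Ψ₂Sq E hE
  have hdisc : E.Δ = 16 * ((e₁ - e₂) * (e₂ - e₃) * (e₁ - e₃)) ^ 2 := by
    have j8 : E.b₈ =
        4 * (e₁ + e₂ + e₃) * (e₁ * e₂ * e₃) - (e₁ * e₂ + e₁ * e₃ + e₂ * e₃) ^ 2 := by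
      have := E.b_relation
      rw [j2, j4, j6] at this
      linear_combination this / 4
    rw [Δ, j2, j4, j6, j8]; ring
  have he12 : e₁ ≠ e₂ := fun h => hΔ (by rw [hdisc, h]; ring)
  have he13 : e₁ ≠ e₃ := fun h => hΔ (by rw [hdisc, h]; ring)
  have hfixed : ∀ g : GQ, g (x₁ + x₃) = x₁ + x₃ ∧ g (x₁ * x₃) = x₁ * x₃ ∧
      g (x₂ + x₄) = x₂ + x₄ ∧ g (x₂ * x₄) = x₂ * x₄ := by
    intro g
    rcases hpairs g with h | h
    · exact h
    exfalso
    -- An element of `G_K` preserves each pair; if it also exchanged them, `x₂` would be a root of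
    -- `(X - x₁)(X - x₃)`.
    have hgH : g r ≠ r := by
      intro hgr
      have hmem := (mem_fixingSubgroup_quadraticField_iff hr g).mpr hgr
      obtain ⟨k1, k2⟩ := hpairsH g hmem
      have : (x₂ - x₁) * (x₂ - x₃) = 0 := by
        linear_combination x₂ * k1 - x₂ * h.1 - k2 + h.2.1
      rcases mul_eq_zero.mp this with h0 | h0
      · exact h12 (sub_eq_zero.mp h0).symm
      · exact h23 (sub_eq_zero.mp h0)
    -- Here `n` is the value at `e₁` of `(X - x₁)(X - x₃)`, and `g n` is that of the other factor.
    refine not_conjugate_factors j2 j4 j6 he12 he13 hr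
      (n := (e₁ : QBar) ^ 2 - e₁ * (x₁ + x₃) + x₁ * x₃) ?_ hgH ?_
    · refine mem_quadraticField_of_fixed fun σ hσ => ?_
      obtain ⟨k1, k2⟩ := hpairsH σ hσ
      rw [map_add, k2, map_sub, map_mul, k1, map_pow, map_ratCast]
    · rw [eval_Ψ₃_eq _ hroots, map_add, h.2.1, map_sub, map_mul, h.1, map_pow, map_ratCast]
      ring
  obtain ⟨s, hs⟩ := exists_rat_of_fixed fun g => (hfixed g).1
  obtain ⟨m, hm⟩ := exists_rat_of_fixed fun g => (hfixed g).2.1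
  obtain ⟨t, ht⟩ := exists_rat_of_fixed fun g => (hfixed g).2.2.1
  obtain ⟨n, hn⟩ := exists_rat_of_fixed fun g => (hfixed g).2.2.2
  have hres := resolvent_Ψ₃ _ hroots
  obtain ⟨k2, k4, k6, k8⟩ := hroots
  simp only [WeierstrassCurve.baseChange, map_b₂, map_b₄, map_b₆, map_b₈, map_Δ, eq_ratCast]
    at k2 k4 k6 k8 hres
  refine E.not_factors_of_rational_two_torsion hΔ j2 j4 j6 (s := s) (t := t) (m := m) (n := n)
    ?_ ?_ ?_ ?_ ?_
  · have : (E.b₂ : QBar) = ((-3 * (s + t) : ℚ) : QBar) := by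
      push_cast; rw [← hs, ← ht, k2]; ring
    exact_mod_cast this
  · have : (E.b₄ : QBar) = ((m + n + s * t : ℚ) : QBar) := by
      push_cast; rw [← hs, ← ht, ← hm, ← hn, k4]; ring
    exact_mod_cast this
  · have : (E.b₆ : QBar) = ((-(s * n + t * m) : ℚ) : QBar) := by
      push_cast; rw [← hs, ← ht, ← hm, ← hn, k6]; ring
    exact_mod_cast this
  · have : (E.b₈ : QBar) = ((3 * (m * n) : ℚ) : QBar) := by
      push_cast; rw [← hm, ← hn, k8]; ring
    exact_mod_cast this
  · have : (((E.b₄ - 3 * (m + n)) ^ 3 : ℚ) : QBar) = (E.Δ : QBar) := by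
      push_cast; rw [← hm, ← hn]; exact hres
    exact_mod_cast this

end Main
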